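/- Let $p$ be a prime. A subgroup $F$ of a group $X$ is called $p$-separable if for every $g\in X\setminus F$ there is a homomorphism $\psi$ of $X$ onto a finite $p$-group with $\psi(g)\notin\psi(F)$; the group $X$ is called residually $p$-finite if its trivial subgroup is $p$-separable; and a subgroup $Y$ of $X$ is called $p'$-isolated if for every $g\in X$ and every prime $q\neq p$, $g^q\in Y$ implies $g\in Y$. **Theorem 2.2.** Let $A$ and $B$ be residually $p$-finite groups, let $H\leqslant A$ and $K\leqslant B$ be cyclic subgroups such that $H$ is $p$-separable in $A$ and $K$ is $p$-separable in $B$, let $\varphi\colon H\to K$ be an isomorphism, and let $G=(A*B;\ H=K,\varphi)$ be the free product of $A$ and $B$ with the subgroups $H$ and $K$ amalgamated according to $\varphi$. Then $G$ is residually $p$-finite and satisfies the following condition: $(**)$ every $p'$-isolated cyclic subgroup of $G$ that is not conjugate in $G$ to any subgroup belonging to $\Delta_A^p\cup\Delta_B^p$ is $p$-separable in $G$, where $\Delta_A^p$ (respectively $\Delta_B^p$) denotes the family of all $p'$-isolated cyclic subgroups of $A$ (respectively of $B$) that are not $p$-separable in $A$ (respectively in $B$), regarded as subgroups of $G$ via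 the natural embeddings of $A$ and $B$ in $G$. -/

import Mathlib

universe u v

/-- A subgroup `F` of `X` is `p`-separable (separable by the class of finite `p`-groups): every
`g ∉ F` admits a homomorphism `ψ` of `X` onto a finite `p`-group with `ψ g ∉ ψ(F)`.
Every finite group has an isomorphic copy in the universe of `X`, so nothing is lost by taking
the target there. -/
def PSeparable (p : ℕ) {X : Type u} [Group X] (F : Subgroup X) : Prop :=
  ∀ g : X, g ∉ F → ∃ (Q : Type u) (_ : Group Q) (ψ : X →* Q),
    Finite Q ∧ IsPGroup p Q ∧ Function.Surjective ψ ∧ ψ g ∉ F.map ψ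

/-- `X` is residually `p`-finite: its trivial subgroup is `p`-separable. -/
def ResiduallyPFinite (p : ℕ) (X : Type u) [Group X] : Prop :=
  PSeparable p (⊥ : Subgroup X)

/-- A subgroup `Y` of `X` is `p'`-isolated: for every `g` in `X` and every prime `q ≠ p`,
`g ^ q ∈ Y` implies `g ∈ Y`. -/
def PPrimeIsolated (p : ℕ) {X : Type u} [Group X] (Y : Subgroup X) : Prop :=
  ∀ (g : X) (q : ℕ), q.Prime → q ≠ p → g ^ q ∈ Y → g ∈ Y

/-- The family of all `p'`-isolated cyclic subgroups of `X` that are not `p`-separable in `X`. -/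
def DeltaP (p : ℕ) (X : Type u) [Group X] : Set (Subgroup X) :=
  {C | IsCyclic C ∧ PPrimeIsolated p C ∧ ¬ PSeparable p C}

/-- Two subgroups of `X` are conjugate. -/
def ConjSubgroups {X : Type u} [Group X] (C D : Subgroup X) : Prop :=
  ∃ x : X, C = D.map (MulAut.conj x).toMonoidHom

section Amalgam

variable {A : Type u} {B : Type v} [Group A] [Group B] {H : Subgroup A} {K : Subgroup B}

/-- The free product `(A * B; H = K, φ)` of `A` and `B` with the subgroups `H` and `K`
amalgamated according to `φ`: the quotient of the free product `A * B` by the normal closure of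
all elements `h (φ h)⁻¹` with `h ∈ H`. -/
abbrev AmalgamatedProduct (φ : H ≃* K) : Type (max u v) :=
  Monoid.Coprod A B ⧸ Subgroup.normalClosure
    {x : Monoid.Coprod A B | ∃ h : H, x =
      Monoid.Coprod.inl (h : A) * (Monoid.Coprod.inr ((φ h : K) : B))⁻¹}

/-- The natural homomorphism of `A` into the amalgamated product. -/
def AmalgamatedProduct.inl (φ : H ≃* K) : A →* AmalgamatedProduct φ :=
  (QuotientGroup.mk' _).comp Monoid.Coprod.inl

/-- The natural homomorphism of `B` into the amalgamated product. -/
def AmalgamatedProduct.inr (φ : H ≃* K) : B →* AmalgamatedProduct φ :=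
  (QuotientGroup.mk' _).comp Monoid.Coprod.inr

/-- Condition `(**)`: every `p'`-isolated cyclic subgroup of the amalgamated product that is not
conjugate to (the image of) any `p'`-isolated, not `p`-separable cyclic subgroup of `A` or of `B`
is `p`-separable. -/
def ConditionStarStar (p : ℕ) (φ : H ≃* K) : Prop :=
  ∀ C : Subgroup (AmalgamatedProduct φ), IsCyclic C → PPrimeIsolated p C →
    (∀ D ∈ DeltaP p A, ¬ ConjSubgroups C (D.map (AmalgamatedProduct.inl φ))) →
    (∀ D ∈ DeltaP p B, ¬ ConjSubgroups C (D.map (AmalgamatedProduct.inr φ))) →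
    PSeparable p C

end Amalgam

/-! Write `G` for the amalgamated product and `U` for its amalgamated subgroup. Everything is read
off finite `p`-quotients of `G`. By Higman's theorem for cyclic amalgamation
(`exists_common_overgroup`), two finite `p`-groups with a common cyclic subgroup lie in a finite
`p`-group. Residual `p`-finiteness lets the images of the generators of `H` and `K` be given equal
orders, so finite `p`-quotients of `A` and `B` are dominated by one of `G` (`exists_hom`).

Such a quotient may kill long words. Iterated wreath-product extensions (`exists_tower`) keep the
kernels on the factors but push all reduced words of bounded length off the image of `U`;
`p`-separability of `H` and `K` makes a given word reduced over some finite quotient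
(`exists_hom_reduced`). This gives the normal form theorem, residual `p`-finiteness, and
separability of cyclic subgroups conjugate into a factor and separable there.

There remains `⟨c⟩` with `c` cyclically reduced. An element `g` that cannot be separated from it
maps to a power of `c` in every finite `p`-quotient, so it commutes with `c`, and some `g ^ b * c ^
a` with `b > 0` lies in `U` (`exists_pow_mul_zpow_mem`). Quotients where `c` has huge order but `U`
has bounded exponent then force `g ^ b' ∈ ⟨c⟩`, `b'` being the prime-to-`p` part of `b`, and
`p'`-isolation gives `g ∈ ⟨c⟩`. -/

/-! ### Combinatorics of reduced words -/

/-- `Reduced S i j n x`: `x` is a product of `n` syllables taken alternately from `S true` and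
`S false`, the first one from `S i` and the last one from `S j`. -/
inductive Reduced {X : Type*} [Group X] (S : Bool → Set X) : Bool → Bool → ℕ → X → Prop
  | single {i : Bool} {x : X} : x ∈ S i → Reduced S i i 1 x
  | cons {i j : Bool} {n : ℕ} {x w : X} :
      x ∈ S i → Reduced S (!i) j n w → Reduced S i j (n + 1) (x * w)

/-- The elements of the factor `F i` outside `U`. -/
def Syllables {X : Type*} [Group X] (F : Bool → Subgroup X) (U : Subgroup X) (i : Bool) : Set X :=
  {x | x ∈ F i ∧ x ∉ U}

namespace Reduced

variable {X : Type*} [Group X]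

section General

variable {S : Bool → Set X}

lemma pos {i j : Bool} {n : ℕ} {x : X} (h : Reduced S i j n x) : 0 < n := by
  cases h <;> omega

lemma of_length_one {i j : Bool} {x : X} (h : Reduced S i j 1 x) : i = j ∧ x ∈ S i := by
  generalize hn : 1 = n at h
  cases h with
  | single hx => exact ⟨rfl, hx⟩
  | cons _ hw => have := hw.pos; omega

lemma mono {T : Bool → Set X} (hST : ∀ i, S i ⊆ T i) {i j : Bool} {n : ℕ} {x : X}
    (h : Reduced S i j n x) : Reduced T i j n x := by
  induction h with
  | single hx => exact .single (hST _ hx)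
  | cons hx _ ih => exact .cons (hST _ hx) ih

lemma append {i j k : Bool} {n m : ℕ} {x y : X} (hx : Reduced S i j n x)
    (hy : Reduced S (!j) k m y) : Reduced S i k (n + m) (x * y) := by
  induction hx with
  | single hx => rw [add_comm]; exact .cons hx hy
  | cons hx _ ih =>
    rw [mul_assoc, add_right_comm]
    exact .cons hx (ih hy)

lemma inv (hS : ∀ i, ∀ x ∈ S i, x⁻¹ ∈ S i) {i j : Bool} {n : ℕ} {x : X}
    (h : Reduced S i j n x) : Reduced S j i n x⁻¹ := by
  induction h with
  | single hx => exact .single (hS _ _ hx)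
  | @cons i j n x w hx hw ih =>
    rw [mul_inv_rev]
    exact ih.append (by simpa using Reduced.single (hS _ _ hx))

lemma pow {i : Bool} {n : ℕ} {x : X} (h : Reduced S i (!i) n x) (k : ℕ) :
    Reduced S i (!i) ((k + 1) * n) (x ^ (k + 1)) := by
  induction k with
  | zero => simpa using h
  | succ k ih =>
    rw [pow_succ, add_mul, one_mul]
    exact ih.append (by simpa using h)

lemma split {i j : Bool} {n : ℕ} {x : X} (h : Reduced S i j n x) :
    ∀ r, 0 < r → r < n → ∃ k d e, x = d * e ∧ Reduced S i k r d ∧ Reduced S (!k) j (n - r) e := by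
  induction h with
  | single hx => intro r h1 h2; omega
  | @cons i j n x w hx hw ih =>
    intro r h1 h2
    rcases Nat.lt_or_ge r 2 with h3 | h3
    · obtain rfl : r = 1 := by omega
      exact ⟨i, x, w, rfl, .single hx, by simpa using hw⟩
    · obtain ⟨k, d, e, rfl, hd, he⟩ := ih (r - 1) (by omega) (by omega)
      refine ⟨k, x * d, e, by rw [mul_assoc], ?_, ?_⟩
      · have := Reduced.cons hx hd
        rwa [Nat.sub_add_cancel h1] at this
      · convert he using 1; omega

end General

section Subgroups

variable {F : Bool → Subgroup X} {U : Subgroup X}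

lemma syllables_inv (i : Bool) (x : X) (hx : x ∈ Syllables F U i) : x⁻¹ ∈ Syllables F U i :=
  ⟨inv_mem hx.1, fun h => hx.2 (by simpa using inv_mem h)⟩

lemma inv' {i j : Bool} {n : ℕ} {x : X} (h : Reduced (Syllables F U) i j n x) :
    Reduced (Syllables F U) j i n x⁻¹ := h.inv syllables_inv

variable (hUF : ∀ i, U ≤ F i)
include hUF

lemma mul_left {i j : Bool} {n : ℕ} {x u : X} (hu : u ∈ U) (h : Reduced (Syllables F U) i j n x) :
    Reduced (Syllables F U) i j n (u * x) := by
  cases h with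
  | single hx =>
    exact .single ⟨mul_mem (hUF _ hu) hx.1, fun h => hx.2 ((Subgroup.mul_mem_cancel_left U hu).1 h)⟩
  | cons hx hw =>
    rw [← mul_assoc]
    exact .cons ⟨mul_mem (hUF _ hu) hx.1,
      fun h => hx.2 ((Subgroup.mul_mem_cancel_left U hu).1 h)⟩ hw

/-- Left multiplication by an element of a factor preserves the existence of a reduced form. -/
lemma exists_mul_left {i : Bool} {s g : X} (hs : s ∈ F i)
    (hg : g ∈ U ∨ ∃ i j n, Reduced (Syllables F U) i j n g) :
    s * g ∈ U ∨ ∃ i j n, Reduced (Syllables F U) i j n (s * g) := by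
  by_cases hsU : s ∈ U
  · rcases hg with hg | ⟨a, b, n, hg⟩
    · exact .inl (mul_mem hsU hg)
    · exact .inr ⟨a, b, n, hg.mul_left hUF hsU⟩
  rcases hg with hg | ⟨a, b, n, hg⟩
  · exact .inr ⟨i, i, 1, .single ⟨mul_mem hs (hUF i hg),
      fun h => hsU ((Subgroup.mul_mem_cancel_right U hg).1 h)⟩⟩
  by_cases hai : a = !i
  · subst hai
    exact .inr ⟨_, _, _, .cons ⟨hs, hsU⟩ hg⟩
  obtain rfl : a = i := by revert hai; cases a <;> cases i <;> simp
  cases hg with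
  | single hx =>
    by_cases hsx : s * g ∈ U
    · exact .inl hsx
    · exact .inr ⟨_, _, _, .single ⟨mul_mem hs hx.1, hsx⟩⟩
  | @cons _ _ _ x w hx hw =>
    rw [← mul_assoc]
    by_cases hsx : s * x ∈ U
    · exact .inr ⟨_, _, _, hw.mul_left hUF hsx⟩
    · exact .inr ⟨_, _, _, .cons ⟨mul_mem hs hx.1, hsx⟩ hw⟩

lemma exists_of_closure (hgen : Subgroup.closure (⋃ i, (F i : Set X)) = ⊤) (g : X) :
    g ∈ U ∨ ∃ i j n, Reduced (Syllables F U) i j n g := by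
  have hg : g ∈ Subgroup.closure (⋃ i, (F i : Set X)) := hgen ▸ Subgroup.mem_top g
  induction hg using Subgroup.closure_induction_left with
  | one => exact .inl (one_mem U)
  | mul_left x hx y _ ih =>
    obtain ⟨i, hi⟩ := Set.mem_iUnion.1 hx
    exact exists_mul_left hUF hi ih
  | inv_mul_cancel x hx y _ ih =>
    obtain ⟨i, hi⟩ := Set.mem_iUnion.1 hx
    exact exists_mul_left hUF (inv_mem hi) ih

/-- Comparison of two reduced words of the same length with the same starting factor. -/
lemma inv_mul {i j j' : Bool} {n : ℕ} {d d' : X} (hd : Reduced (Syllables F U) i j n d)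
    (hd' : Reduced (Syllables F U) i j' n d') :
    j = j' ∧ (d'⁻¹ * d ∈ U ∨ ∃ k, Reduced (Syllables F U) j j k (d'⁻¹ * d)) := by
  induction n generalizing i d d' with
  | zero => exact absurd hd.pos (lt_irrefl 0)
  | succ n ih =>
    cases hd with
    | single hx =>
      cases hd' with
      | single hx' =>
        refine ⟨rfl, ?_⟩
        by_cases h : d'⁻¹ * d ∈ U
        · exact .inl h
        · exact .inr ⟨1, .single ⟨mul_mem (inv_mem hx'.1) hx.1, h⟩⟩
      | cons _ hw => exact absurd hw.pos (lt_irrefl 0)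
    | @cons _ _ _ x w hx hw =>
      cases hd' with
      | single _ => exact absurd hw.pos (lt_irrefl 0)
      | @cons _ _ _ x' w' hx' hw' =>
        obtain ⟨rfl, -⟩ := ih hw hw'
        refine ⟨rfl, ?_⟩
        have e : (x' * w')⁻¹ * (x * w) = w'⁻¹ * ((x'⁻¹ * x) * w) := by group
        rw [e]
        by_cases h : x'⁻¹ * x ∈ U
        · exact (ih (hw.mul_left hUF h) hw').2
        · exact .inr ⟨_, hw'.inv'.append
            (.cons (by simpa using ⟨mul_mem (inv_mem hx'.1) hx.1, h⟩) (by simpa using hw))⟩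

/-! ### Consequences of the normal form theorem, taken as hypothesis `hU` and supplied later by
finite quotients -/

variable (hU : ∀ i j n x, Reduced (Syllables F U) i j n x → x ∉ U)

omit hUF in
include hU in
-- Inverting one word and appending the other would give a reduced word with value `1 ∈ U`.
lemma start_unique {i j j' : Bool} {n n' : ℕ} {x : X} (h : Reduced (Syllables F U) i j n x)
    (h' : Reduced (Syllables F U) (!i) j' n' x) : False := by
  have := hU _ _ _ _ (h'.inv'.append (by simpa using h))
  simp at this

include hU in
-- Otherwise `d'⁻¹ * d` is reduced with both ends in factor `j`, and followed by `e` it shows `e'`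
-- starting in factor `j`, whereas `e'` starts in the other one.
lemma prefix_unique {i j j' k k' : Bool} {n m m' : ℕ} {d d' e e' : X}
    (hd : Reduced (Syllables F U) i j n d) (hd' : Reduced (Syllables F U) i j' n d')
    (he : Reduced (Syllables F U) (!j) k m e) (he' : Reduced (Syllables F U) (!j') k' m' e')
    (h : d * e = d' * e') : d'⁻¹ * d ∈ U := by
  obtain ⟨rfl, h1 | ⟨r, h1⟩⟩ := hd.inv_mul hUF hd'
  · exact h1
  · have h2 : d'⁻¹ * d * e = e' := by rw [mul_assoc, h, inv_mul_cancel_left]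
    exact (start_unique hU (h2 ▸ h1.append he) he').elim

include hU in
lemma length_le {i j j' : Bool} {n n' : ℕ} {x : X} (h : Reduced (Syllables F U) i j n x)
    (h' : Reduced (Syllables F U) i j' n' x) : n ≤ n' := by
  by_contra! hlt
  obtain ⟨k, d, e, rfl, hd, he⟩ := h.split n' h'.pos hlt
  obtain ⟨rfl, h1⟩ := h'.inv_mul hUF hd
  rw [inv_mul_cancel_left] at h1
  rcases h1 with h1 | ⟨r, h1⟩
  · exact hU _ _ _ _ he h1
  · exact start_unique hU h1 he

/-- Every reduced word is conjugate to an element of a factor or to a cyclically reduced word. -/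
lemma exists_conj {i j : Bool} {n : ℕ} {x : X} (h : Reduced (Syllables F U) i j n x) :
    ∃ g : X, (∃ k, g * x * g⁻¹ ∈ F k) ∨
      ∃ k m, Reduced (Syllables F U) k (!k) m (g * x * g⁻¹) := by
  induction n using Nat.strong_induction_on generalizing i j x with
  | _ n ih =>
  by_cases hij : j = !i
  · exact ⟨1, .inr ⟨i, n, by simpa [hij] using h⟩⟩
  obtain rfl : j = i := by revert hij; cases j <;> cases i <;> simp
  cases h with
  | single hx => exact ⟨1, .inl ⟨j, by simpa using hx.1⟩⟩
  | @cons _ _ n x w hx hw =>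
    have hn : 1 < n := by
      by_contra! hn
      obtain rfl : n = 1 := by have := hw.pos; omega
      simpa using hw.of_length_one.1
    obtain ⟨k, d, e, rfl, hd, he⟩ := hw.split (n - 1) (by omega) (by omega)
    rw [show n - (n - 1) = 1 by omega] at he
    generalize hk : (!k) = k' at he
    obtain ⟨rfl, hes⟩ := he.of_length_one
    obtain rfl : k = !k' := by rw [← hk, Bool.not_not]
    -- Conjugation by the last syllable merges it with the first: the word gets shorter if `e * x ∈
    -- U`, and cyclically reduced otherwise.
    have e1 : e * (x * (d * e)) * e⁻¹ = e * x * d := by group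
    by_cases hex : e * x ∈ U
    · obtain ⟨g, hg⟩ := ih (n - 1) (by omega) (hd.mul_left hUF hex)
      refine ⟨g * e, ?_⟩
      rw [show g * e * (x * (d * e)) * (g * e)⁻¹ = g * (e * x * d) * g⁻¹ by group]
      exact hg
    · refine ⟨e, .inr ⟨k', n - 1 + 1, ?_⟩⟩
      rw [e1]
      exact .cons ⟨mul_mem hes.1 hx.1, hex⟩ hd

include hU in
/-- A shortest element, among the `x * c ^ t`, of the centralizer of a cyclically reduced `c` is
a prefix of `c` modulo `U`, provided that its last syllable does not meet the first one of `c`. -/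
lemma exists_prefix {i : Bool} {n : ℕ} {c : X} (hc : Reduced (Syllables F U) i (!i) n c) :
    ∃ d : ℕ → X, ∀ (x : X) (a : Bool) (k : ℕ), Commute x c → Reduced (Syllables F U) a (!i) k x →
      (x * c⁻¹ ∉ U) → (∀ a b k', Reduced (Syllables F U) a b k' (x * c⁻¹) → k ≤ k') →
      ∃ r < n, (d r)⁻¹ * x ∈ U := by
  have hsplit : ∀ r, ∃ d, 0 < r → r < n → ∃ k e, c = d * e ∧ Reduced (Syllables F U) i k r d ∧
      Reduced (Syllables F U) (!k) (!i) (n - r) e := by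
    intro r
    by_cases hr : 0 < r ∧ r < n
    · obtain ⟨k, d, e, h⟩ := hc.split r hr.1 hr.2
      exact ⟨d, fun _ _ => ⟨k, e, h⟩⟩
    · exact ⟨1, fun h1 h2 => absurd ⟨h1, h2⟩ hr⟩
  choose d hd using hsplit
  refine ⟨d, fun x a k hxc hx hxU hmin => ?_⟩
  have hcx : Reduced (Syllables F U) a (!i) (k + n) (x * c) := hx.append (by simpa using hc)
  -- If `x` started in the factor where `c` ends, `c⁻¹ * x * c = x` would be reduced and longer than
  -- `x`.
  by_cases ha : a = !i
  · subst ha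
    have h1 := hc.inv'.append (y := x * c) (by simpa using hcx)
    rw [hxc.eq, inv_mul_cancel_left] at h1
    have := length_le hUF hU h1 hx
    have := hc.pos
    omega
  obtain rfl : a = i := by revert ha; cases a <;> cases i <;> simp
  -- Now `x * c = c * x` is reduced both ways, so prefixes agree modulo `U`: a shorter `x` is a
  -- prefix of `c`, equal lengths give `x * c⁻¹ ∈ U`, and a longer `x` is shortened by `c⁻¹`.
  rcases lt_trichotomy k n with hkn | hkn | hkn
  · obtain ⟨b, e, hce, h1, h2⟩ := hd k hx.pos hkn
    refine ⟨k, hkn, prefix_unique hUF hU hx h1 (by simpa using hc)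
      (h2.append (by simpa using hx)) ?_⟩
    rw [hxc.eq, ← mul_assoc, ← hce]
  · subst hkn
    have h1 := prefix_unique hUF hU hx hc (by simpa using hc) (by simpa using hx) hxc.eq
    exact absurd (by rwa [hxc.symm.inv_left.eq] at h1) hxU
  · obtain ⟨b, d', e, rfl, h1, h2⟩ := hx.split n hc.pos hkn
    have h3 := prefix_unique hUF hU h1 hc (h2.append (by simpa using hc)) (by simpa using hx)
      (by rw [← mul_assoc, hxc.eq])
    have h4 := h2.mul_left hUF h3
    rw [mul_assoc, ← hxc.symm.inv_left.eq.symm] at h4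
    have := hmin _ _ _ h4
    have := hc.pos
    omega

include hU in
/-- Modulo `U`, an element commuting with a cyclically reduced `c` has a power in `⟨c⟩`. -/
theorem exists_pow_mul_zpow_mem (hgen : Subgroup.closure (⋃ i, (F i : Set X)) = ⊤) {i : Bool}
    {n : ℕ} {c g : X} (hc : Reduced (Syllables F U) i (!i) n c) (hg : Commute g c) :
    ∃ (b : ℕ) (a : ℤ), 0 < b ∧ g ^ b * c ^ a ∈ U := by
  obtain ⟨d, hd⟩ := exists_prefix hUF hU hc
  obtain ⟨d', hd'⟩ := exists_prefix hUF hU (i := !i) (by simpa using hc.inv')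
  -- Finitely many coset representatives suffice: `1` (index `n`) and the proper prefixes of `c` or
  -- of `c⁻¹`, according to the Boolean. The exponent `t` minimises the length of `x * c ^ t`.
  have key : ∀ x : X, Commute x c → ∃ (t : ℤ) (r : Fin (n + 1) × Bool),
      (if (r.1 : ℕ) = n then 1 else if r.2 then d r.1 else d' r.1)⁻¹ * (x * c ^ t) ∈ U := by
    intro x hx
    by_cases h0 : ∃ t : ℤ, x * c ^ t ∈ U
    · obtain ⟨t, ht⟩ := h0
      exact ⟨t, (Fin.last n, true), by simpa using ht⟩
    push Not at h0
    have hex : ∃ k, ∃ (t : ℤ) (a b : Bool), Reduced (Syllables F U) a b k (x * c ^ t) := by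
      obtain h | ⟨a, b, k, h⟩ := exists_of_closure hUF hgen (x * c ^ (0 : ℤ))
      · exact absurd h (h0 0)
      · exact ⟨k, 0, a, b, h⟩
    classical
    obtain ⟨t, a, b, ht⟩ := Nat.find_spec hex
    have hmin : ∀ (t : ℤ) (a b : Bool) (k' : ℕ),
        Reduced (Syllables F U) a b k' (x * c ^ t) → Nat.find hex ≤ k' :=
      fun t a b k' h => Nat.find_min' hex ⟨t, a, b, h⟩
    have hcomm : Commute (x * c ^ t) c := hx.mul_left ((Commute.refl c).zpow_left t)
    have e1 : x * c ^ t * c⁻¹ = x * c ^ (t - 1) := by rw [zpow_sub_one, mul_assoc]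
    have e2 : x * c ^ t * c⁻¹⁻¹ = x * c ^ (t + 1) := by rw [zpow_add_one, mul_assoc, inv_inv]
    by_cases hb : b = !i
    · subst hb
      obtain ⟨r, hr, h⟩ := hd _ _ _ hcomm ht (by rw [e1]; exact h0 _)
        (fun a b k' h => hmin _ a b k' (by rwa [e1] at h))
      exact ⟨t, (⟨r, by omega⟩, true), by simpa [hr.ne] using h⟩
    · obtain rfl : b = i := by revert hb; cases b <;> cases i <;> simp
      obtain ⟨r, hr, h⟩ := hd' _ _ _ hcomm.inv_right (by simpa using ht) (by rw [e2]; exact h0 _)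
        (fun a b k' h => hmin _ a b k' (by rwa [e2] at h))
      exact ⟨t, (⟨r, by omega⟩, false), by simpa [hr.ne] using h⟩
  -- Pigeonhole: two powers of `g` share a representative.
  choose t r hr using fun m : ℕ => key (g ^ m) (hg.pow_left m)
  obtain ⟨m, m', hne, heq⟩ := Finite.exists_ne_map_eq_of_infinite r
  wlog hlt : m < m' generalizing m m'
  · exact this m' m hne.symm heq.symm (by omega)
  refine ⟨m' - m, t m' - t m, by omega, ?_⟩
  have h1 := mul_mem (inv_mem (hr m)) (heq ▸ hr m')
  have e : ∀ y : X, (y⁻¹ * (g ^ m * c ^ t m))⁻¹ * (y⁻¹ * (g ^ m' * c ^ t m')) =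
      g ^ (m' - m) * c ^ (t m' - t m) := by
    intro y
    have hgc : Commute (c ^ t m) (g ^ (m' - m)) := (hg.pow_left _).symm.zpow_left _
    calc _ = (c ^ t m)⁻¹ * ((g ^ m)⁻¹ * g ^ m') * c ^ t m' := by group
      _ = _ := by
        obtain ⟨k, rfl⟩ := Nat.exists_eq_add_of_le hlt.le
        rw [pow_add, inv_mul_cancel_left, Nat.add_sub_cancel_left] at *
        rw [hgc.inv_left.eq, mul_assoc, ← zpow_neg, ← zpow_add, neg_add_eq_sub]
  rwa [e] at h1

end Subgroups

end Reduced

/-! ### Wreath products and lifting by cocycles -/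

/-- The wreath product of `V` and `R`, acting on `R × V` by `(y, s) ↦ (pt * y, s + fn y)`. -/
@[ext] structure CocycleExtension (V R : Type*) where
  /-- the `V`-valued function on the base -/
  fn : R → V
  /-- the element of the base group -/
  pt : R

namespace CocycleExtension

variable {V R : Type*} [AddCommGroup V] [Group R]

instance : Mul (CocycleExtension V R) :=
  ⟨fun a b => ⟨fun y => a.fn (b.pt * y) + b.fn y, a.pt * b.pt⟩⟩

instance : One (CocycleExtension V R) := ⟨⟨fun _ => 0, 1⟩⟩

instance : Inv (CocycleExtension V R) := ⟨fun a => ⟨fun y => -a.fn (a.pt⁻¹ * y), a.pt⁻¹⟩⟩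

@[simp] lemma mul_fn (a b : CocycleExtension V R) (y : R) :
    (a * b).fn y = a.fn (b.pt * y) + b.fn y := rfl
@[simp] lemma mul_pt (a b : CocycleExtension V R) : (a * b).pt = a.pt * b.pt := rfl
@[simp] lemma one_fn (y : R) : (1 : CocycleExtension V R).fn y = 0 := rfl
@[simp] lemma one_pt : (1 : CocycleExtension V R).pt = 1 := rfl
@[simp] lemma inv_fn (a : CocycleExtension V R) (y : R) : a⁻¹.fn y = -a.fn (a.pt⁻¹ * y) := rfl
@[simp] lemma inv_pt (a : CocycleExtension V R) : a⁻¹.pt = a.pt⁻¹ := rfl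

instance : Group (CocycleExtension V R) :=
  Group.ofLeftAxioms (fun a b c => by ext <;> simp [mul_assoc, add_assoc])
    (fun a => by ext <;> simp) (fun a => by ext <;> simp)

/-- The projection onto the base group. -/
def toBase : CocycleExtension V R →* R where
  toFun := pt
  map_one' := rfl
  map_mul' _ _ := rfl

@[simp] lemma toBase_apply (a : CocycleExtension V R) : toBase a = a.pt := rfl

instance [Finite V] [Finite R] : Finite (CocycleExtension V R) :=
  Finite.of_injective (fun a => (a.fn, a.pt)) fun a b h => by
    ext
    · exact congrFun (congrArg Prod.fst h) _
    · exact congrArg Prod.snd h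

lemma pow_eq_of_pt_eq_one {a : CocycleExtension V R} (ha : a.pt = 1) (n : ℕ) :
    (∀ y, (a ^ n).fn y = n • a.fn y) ∧ (a ^ n).pt = 1 := by
  induction n with
  | zero => simp
  | succ n ih => simp [pow_succ, ih, ha, add_smul]

lemma isPGroup {p : ℕ} (hR : IsPGroup p R) (hV : ∀ v : V, p • v = 0) :
    IsPGroup p (CocycleExtension V R) := by
  intro a
  obtain ⟨k, hk⟩ := hR a.pt
  have h : (a ^ p ^ k).pt = 1 := by
    rw [← toBase_apply, map_pow, toBase_apply, hk]
  refine ⟨k + 1, ?_⟩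
  rw [pow_succ, pow_mul]
  obtain ⟨h1, h2⟩ := pow_eq_of_pt_eq_one h p
  ext y
  · rw [h1, hV, one_fn]
  · exact h2

/-- The homomorphism given by a cocycle. -/
def lift {X : Type*} [Group X] (ρ : X →* R) (f : X → R → V)
    (hf : ∀ g h y, f (g * h) y = f g (ρ h * y) + f h y) : X →* CocycleExtension V R :=
  MonoidHom.mk' (fun g => ⟨f g, ρ g⟩) fun g h => by ext <;> simp [hf]

section lift

variable {X : Type*} [Group X] (ρ : X →* R) (f : X → R → V)
  (hf : ∀ g h y, f (g * h) y = f g (ρ h * y) + f h y)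

@[simp] lemma lift_fn (g : X) : (lift ρ f hf g).fn = f g := rfl
@[simp] lemma lift_pt (g : X) : (lift ρ f hf g).pt = ρ g := rfl

end lift

/-- An equivariant map from `R` to the range of `θ`, lifted to `C`. -/
lemma exists_equivariant_lift {C : Type*} [Group C] (θ : C →* R) :
    ∃ (t : R → C) (rep : R → R), (∀ y, θ (t y) * rep y = y) ∧
      (∀ c y, rep (θ c * y) = rep y) ∧ ∀ c y, θ (t (θ c * y)) = θ c * θ (t y) := by
  let s := QuotientGroup.rightRel θ.range
  let rep : R → R := fun y => (Quotient.mk s y).out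
  have hrep : ∀ y, ∃ c, θ c * rep y = y := by
    intro y
    have h1 : s (rep y) y := Quotient.exact (Quotient.out_eq (Quotient.mk s y))
    obtain ⟨c, hc⟩ := QuotientGroup.rightRel_apply.1 h1
    exact ⟨c, by rw [hc, inv_mul_cancel_right]⟩
  have hrep' : ∀ c y, rep (θ c * y) = rep y := by
    intro c y
    have : Quotient.mk s (θ c * y) = Quotient.mk s y := Quotient.sound <| by
      refine QuotientGroup.rightRel_apply.2 ⟨c⁻¹, by simp⟩
    simp only [rep, this]
  choose t ht using hrep
  refine ⟨t, rep, ht, hrep', fun c y => mul_right_cancel (b := rep y) ?_⟩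
  rw [mul_assoc, ht, ← hrep' c y, ht]

/-- Two lifts of a homomorphism of `C` that agree on its kernel differ by a coboundary. -/
lemma exists_coboundary {C : Type*} [Group C] (θ : C →* R) (h : C → R → V)
    (hh : ∀ c d y, h (c * d) y = h c (θ d * y) + h d y) (hker : ∀ c, θ c = 1 → ∀ y, h c y = 0) :
    ∃ w : R → V, ∀ c y, h c y = w (θ c * y) - w y := by
  obtain ⟨t, rep, ht, hrep', hequi⟩ := exists_equivariant_lift θ
  -- This potential works because `c * t y` and `t (θ c * y)` differ by an element of the kernel of
  -- `θ`, where `h` vanishes.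
  refine ⟨fun y => h (t y) (rep y), fun c y => ?_⟩
  have h1 : θ ((c * t y)⁻¹ * t (θ c * y)) = 1 := by
    rw [map_mul, map_inv, map_mul, inv_mul_eq_one, hequi]
  have h2 := hh (c * t y) ((c * t y)⁻¹ * t (θ c * y)) (rep y)
  rw [mul_inv_cancel_left, h1, one_mul, hker _ h1, add_zero, hh, ht] at h2
  simp [hrep', h2]

/-- Two lifts of compatible homomorphisms can be made compatible. -/
lemma exists_compatible_lifts {C P Q : Type*} [Group C] [Group P] [Group Q] (i : C →* P)
    (j : C →* Q) (α : P →* R) (β : Q →* R) (hαβ : α.comp i = β.comp j) (f : P → R → V)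
    (f' : Q → R → V) (hf : ∀ g h y, f (g * h) y = f g (α h * y) + f h y)
    (hf' : ∀ g h y, f' (g * h) y = f' g (β h * y) + f' h y)
    (hker : ∀ c, α (i c) = 1 → ∀ y, f (i c) y = f' (j c) y) :
    ∃ (α' : P →* CocycleExtension V R) (β' : Q →* CocycleExtension V R),
      α'.comp i = β'.comp j ∧
      (∀ g, α' g = 1 → α g = 1 ∧ ∀ y, f g y = 0) ∧
      (∀ g, β' g = 1 → β g = 1 ∧ ∀ y, f' g y = 0) := by
  have hαβ' : ∀ c, β (j c) = α (i c) := fun c => (DFunLike.congr_fun hαβ c).symm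
  obtain ⟨w, hw⟩ := exists_coboundary (α.comp i) (fun c y => f (i c) y - f' (j c) y)
    (fun c d y => by simp only [map_mul, hf, hf', hαβ', MonoidHom.comp_apply]; abel)
    (fun c hc y => by rw [hker c hc, sub_self])
  -- Adding the coboundary of `w` on all of `Q` makes the lifts agree on `C` and changes nothing on
  -- the kernel of `β`.
  refine ⟨lift α f hf, lift β (fun q y => f' q y + (w (β q * y) - w y)) ?_, ?_, ?_, ?_⟩
  · intro g h y
    simp only [hf', map_mul, mul_assoc]
    abel
  · ext c y
    · have := hw c y
      simp only [MonoidHom.comp_apply, lift_fn, hαβ'] at this ⊢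
      rw [← this]
      abel
    · simp [hαβ']
  · intro g hg
    exact ⟨congrArg pt hg, fun y => congrFun (congrArg fn hg) y⟩
  · intro g hg
    have h1 : β g = 1 := congrArg pt hg
    refine ⟨h1, fun y => ?_⟩
    simpa [h1] using congrFun (congrArg fn hg) y

/-- The cocycle of an extension by a cyclic group of prime order. -/
lemma exists_cocycle {p : ℕ} {P : Type*} [Group P] (α : P →* R) (z : P) (hz : orderOf z = p)
    (hcen : ∀ g, Commute z g) (hker : ∀ g, α g = 1 ↔ ∃ t : ℤ, g = z ^ t) :
    ∃ f : P → R → ZMod p, (∀ g h y, f (g * h) y = f g (α h * y) + f h y) ∧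
      ∀ (t : ℤ) y, f (z ^ t) y = t := by
  obtain ⟨l, -, -, -, hl⟩ := exists_equivariant_lift α
  -- As in the Krasner–Kaloujnine embedding, equivariance of `α ∘ l` puts this product in the kernel
  -- `⟨z⟩`; the cocycle records its exponent.
  have key : ∀ g y, ∃ t : ℤ, (l (α g * y))⁻¹ * g * l y = z ^ t := by
    intro g y
    refine (hker _).1 ?_
    rw [map_mul, map_mul, map_inv, hl]
    group
  choose T hT using key
  have hcast : ∀ a b : ℤ, z ^ a = z ^ b → (a : ZMod p) = b := by
    intro a b hab
    rwa [ZMod.intCast_eq_intCast_iff, ← hz, ← zpow_eq_zpow_iff_modEq]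
  refine ⟨fun g y => T g y, fun g h y => ?_, fun t y => ?_⟩
  · rw [← Int.cast_add]
    apply hcast
    rw [zpow_add, ← hT, ← hT, ← hT, map_mul, mul_assoc (α g)]
    group
  · apply hcast
    have h1 : α (z ^ t) = 1 := (hker _).2 ⟨t, rfl⟩
    rw [← hT, h1, one_mul, mul_assoc, ((hcen (l y)).zpow_left t).eq, inv_mul_cancel_left]

end CocycleExtension

/-! ### Finite `p`-groups and Higman's theorem -/

section FinitePGroups

variable {p : ℕ} [hp : Fact p.Prime]

lemma IsPGroup.exists_central_orderOf_eq {P : Type*} [Group P] [Finite P] [Nontrivial P]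
    (hP : IsPGroup p P) : ∃ z : P, orderOf z = p ∧ ∀ g, Commute z g := by
  have := hP.center_nontrivial
  obtain ⟨n, hn, hcard⟩ := (hP.to_subgroup (Subgroup.center P)).nontrivial_iff_card.1 this
  obtain ⟨z, hz⟩ := exists_prime_orderOf_dvd_card' (G := Subgroup.center P) p
    (by rw [hcard]; exact dvd_pow_self p hn.ne')
  exact ⟨z, by rw [← hz, Subgroup.orderOf_coe], fun g => (Subgroup.mem_center_iff.1 z.2 g).symm⟩

/-- The quotient of a finite `p`-group by a central element of order `p`. -/
lemma IsPGroup.exists_quotient_zpowers {P : Type u} [Group P] [Finite P] (hP : IsPGroup p P)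
    {z : P} (hz : orderOf z = p) (hcen : ∀ g, Commute z g) :
    ∃ (P' : Type u) (_ : Group P') (π : P →* P'), Finite P' ∧ IsPGroup p P' ∧
      Nat.card P' < Nat.card P ∧ ∀ g, π g = 1 ↔ ∃ t : ℤ, g = z ^ t := by
  have hN : (Subgroup.zpowers z).Normal := ⟨fun n hn g => by
    obtain ⟨t, rfl⟩ := Subgroup.mem_zpowers_iff.1 hn
    rw [← ((hcen g).zpow_left t).eq, mul_inv_cancel_right]
    exact hn⟩
  refine ⟨P ⧸ Subgroup.zpowers z, inferInstance, QuotientGroup.mk' _, inferInstance,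
    hP.to_quotient _, ?_, fun g => ?_⟩
  · rw [Subgroup.card_eq_card_quotient_mul_card_subgroup (Subgroup.zpowers z), Nat.card_zpowers, hz]
    exact lt_mul_of_one_lt_right Nat.card_pos hp.out.one_lt
  · rw [QuotientGroup.mk'_apply, QuotientGroup.eq_one_iff, Subgroup.mem_zpowers_iff]
    simp only [eq_comm]

/-- The order of an element of a finite `p`-group can be lowered at will in quotients. -/
lemma IsPGroup.exists_orderOf_eq {P : Type u} [Group P] [Finite P] (hP : IsPGroup p P) {x : P}
    {m n : ℕ} (hx : orderOf x = p ^ m) (hnm : n ≤ m) :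
    ∃ (Q : Type u) (_ : Group Q) (π : P →* Q), Finite Q ∧ IsPGroup p Q ∧
      orderOf (π x) = p ^ n := by
  induction hN : Nat.card P using Nat.strong_induction_on generalizing P m with
  | _ N ih =>
  rcases hnm.eq_or_lt with rfl | hlt
  · exact ⟨P, inferInstance, MonoidHom.id P, inferInstance, hP, hx⟩
  have : Nontrivial P := ⟨x, 1, fun h => by
    rw [h, orderOf_one] at hx
    exact (Nat.one_lt_pow (by omega) hp.out.one_lt).ne hx⟩
  obtain ⟨z, hz, hcen⟩ := hP.exists_central_orderOf_eq
  obtain ⟨P', _, π, _, hP', hcard, hker⟩ := hP.exists_quotient_zpowers hz hcen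
  obtain ⟨k, hk⟩ := IsPGroup.iff_orderOf.1 hP' (π x)
  -- Killing `z` divides the order of `x` by at most `p`, so `p ^ n` is not skipped.
  have hmk : m ≤ k + 1 := by
    have h1 : π (x ^ p ^ k) = 1 := by rw [map_pow, ← hk, pow_orderOf_eq_one]
    obtain ⟨t, ht⟩ := (hker _).1 h1
    have h2 : x ^ p ^ (k + 1) = 1 := by
      rw [pow_succ, pow_mul, ht, ← zpow_natCast, ← zpow_mul, mul_comm, zpow_mul, zpow_natCast, ← hz,
        pow_orderOf_eq_one, one_zpow]
    exact (Nat.pow_dvd_pow_iff_le_right hp.out.one_lt).1 (hx ▸ orderOf_dvd_of_pow_eq_one h2)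
  obtain ⟨Q, _, ψ, hQ⟩ := ih _ (hN ▸ hcard) hP' hk (by omega) rfl
  exact ⟨Q, inferInstance, ψ.comp π, hQ⟩

lemma ZMod.natCast_smul_eq_zero (v : ZMod p) : p • v = 0 := by simp

/-- The inductive step for amalgams in which a central subgroup of order `p` avoids the
amalgamated subgroup. -/
lemma exists_common_extension_of_disjoint {C P P' R : Type*} {Q : Type*} [Group C] [Group P]
    [Group P'] [Group Q] [Group R] {i : C →* P} {j : C →* Q}
    {z : P} (hz : orderOf z = p) (hcen : ∀ g, Commute z g) {π : P →* P'}
    (hπ : ∀ g, π g = 1 ↔ ∃ t : ℤ, g = z ^ t) (hdis : ∀ (c : C) (t : ℤ), i c = z ^ t → i c = 1)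
    {α : P' →* R} {β : Q →* R} (hα : Function.Injective α) (hβ : Function.Injective β)
    (h : (α.comp π).comp i = β.comp j) :
    ∃ (α' : P →* CocycleExtension (ZMod p) R) (β' : Q →* CocycleExtension (ZMod p) R),
      Function.Injective α' ∧ Function.Injective β' ∧ α'.comp i = β'.comp j := by
  have hαπ : ∀ g, (α.comp π) g = 1 ↔ ∃ t : ℤ, g = z ^ t := fun g => by
    rw [MonoidHom.comp_apply, map_eq_one_iff α hα, hπ]
  obtain ⟨f, hf, hfz⟩ := CocycleExtension.exists_cocycle (α.comp π) z hz hcen hαπ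
  have hf1 : ∀ y, f 1 y = 0 := fun y => by simpa using hfz 0 y
  obtain ⟨α', β', h1, h2, h3⟩ := CocycleExtension.exists_compatible_lifts i j (α.comp π) β h f
    (fun _ _ => 0) hf (by simp) (fun c hc y => by
      obtain ⟨t, ht⟩ := (hαπ _).1 hc
      rw [hdis c t ht, hf1])
  refine ⟨α', β', (injective_iff_map_eq_one _).2 fun g hg => ?_,
    (injective_iff_map_eq_one _).2 fun g hg => ?_, h1⟩
  · obtain ⟨t, rfl⟩ := (hαπ g).1 (h2 g hg).1
    have := (h2 _ hg).2 1
    rw [hfz, ZMod.intCast_zmod_eq_zero_iff_dvd] at this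
    exact orderOf_dvd_iff_zpow_eq_one.1 (hz ▸ this)
  · exact (map_eq_one_iff β hβ).1 (h3 g hg).1

/-- The inductive step for amalgams in which a central subgroup of order `p` of both factors lies
in the amalgamated subgroup. -/
lemma exists_common_extension_of_common {C P P' Q Q' R : Type*} [Group C] [Group P]
    [Group P'] [Group Q] [Group Q'] [Group R] {i : C →* P} {j : C →* Q} (hker : i.ker = j.ker)
    {c : C} (hz : orderOf (i c) = p) (hz' : orderOf (j c) = p)
    (hcen : ∀ g, Commute (i c) g) (hcen' : ∀ g, Commute (j c) g) {π : P →* P'} {π' : Q →* Q'}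
    (hπ : ∀ g, π g = 1 ↔ ∃ t : ℤ, g = i c ^ t) (hπ' : ∀ g, π' g = 1 ↔ ∃ t : ℤ, g = j c ^ t)
    {α : P' →* R} {β : Q' →* R} (hα : Function.Injective α) (hβ : Function.Injective β)
    (h : (α.comp π).comp i = (β.comp π').comp j) :
    ∃ (α' : P →* CocycleExtension (ZMod p) R) (β' : Q →* CocycleExtension (ZMod p) R),
      Function.Injective α' ∧ Function.Injective β' ∧ α'.comp i = β'.comp j := by
  have hαπ : ∀ g, (α.comp π) g = 1 ↔ ∃ t : ℤ, g = i c ^ t := fun g => by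
    rw [MonoidHom.comp_apply, map_eq_one_iff α hα, hπ]
  have hβπ : ∀ g, (β.comp π') g = 1 ↔ ∃ t : ℤ, g = j c ^ t := fun g => by
    rw [MonoidHom.comp_apply, map_eq_one_iff β hβ, hπ']
  obtain ⟨f, hf, hfz⟩ := CocycleExtension.exists_cocycle (α.comp π) (i c) hz hcen hαπ
  obtain ⟨f', hf', hfz'⟩ := CocycleExtension.exists_cocycle (β.comp π') (j c) hz' hcen' hβπ
  obtain ⟨α', β', h1, h2, h3⟩ := CocycleExtension.exists_compatible_lifts i j (α.comp π)
    (β.comp π') h f f' hf hf' (fun d hd y => by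
      obtain ⟨t, ht⟩ := (hαπ _).1 hd
      have h4 : d * (c ^ t)⁻¹ ∈ i.ker := by simp [MonoidHom.mem_ker, ht]
      have h5 : j d = j c ^ t := by
        rw [hker, MonoidHom.mem_ker, map_mul, map_inv, mul_inv_eq_one, map_zpow] at h4
        exact h4
      rw [ht, h5, hfz, hfz'])
  refine ⟨α', β', (injective_iff_map_eq_one _).2 fun g hg => ?_,
    (injective_iff_map_eq_one _).2 fun g hg => ?_, h1⟩
  · obtain ⟨t, rfl⟩ := (hαπ g).1 (h2 g hg).1
    have := (h2 _ hg).2 1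
    rw [hfz, ZMod.intCast_zmod_eq_zero_iff_dvd] at this
    exact orderOf_dvd_iff_zpow_eq_one.1 (hz ▸ this)
  · obtain ⟨t, rfl⟩ := (hβπ g).1 (h3 g hg).1
    have := (h3 _ hg).2 1
    rw [hfz', ZMod.intCast_zmod_eq_zero_iff_dvd] at this
    exact orderOf_dvd_iff_zpow_eq_one.1 (hz' ▸ this)

/-- If a central element of order `p` has a nontrivial power in a cyclic subgroup `⟨x⟩` with
`orderOf x = p ^ (n + 1)`, then it generates the same subgroup as `x ^ p ^ n`, which is central of
order `p`. -/
lemma orderOf_pow_of_meets {P : Type*} [Group P] {x z : P} {n : ℕ} (hx : orderOf x = p ^ (n + 1))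
    (hz : orderOf z = p) (hcen : ∀ g, Commute z g) {s t : ℤ} (hst : x ^ s = z ^ t)
    (hne : x ^ s ≠ 1) : orderOf (x ^ p ^ n) = p ∧ ∀ g, Commute (x ^ p ^ n) g := by
  refine ⟨?_, fun g => ?_⟩
  · rw [orderOf_pow_of_dvd (pow_ne_zero _ hp.out.ne_zero) (hx ▸ pow_dvd_pow p n.le_succ), hx,
      pow_succ, Nat.mul_div_cancel_left _ (pow_pos hp.out.pos n)]
  -- This forces `s = p ^ n * k` with `k` prime to `p`; Bézout then makes `x ^ p ^ n` a power of
  -- `z`.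
  have h1 : (x ^ s) ^ (p : ℤ) = 1 := by
    rw [hst, ← zpow_mul, mul_comm, zpow_mul, zpow_natCast, ← hz, pow_orderOf_eq_one, one_zpow]
  rw [← zpow_mul, ← orderOf_dvd_iff_zpow_eq_one, hx, pow_succ, Nat.cast_mul] at h1
  obtain ⟨k, rfl⟩ := Int.dvd_of_mul_dvd_mul_right (by exact_mod_cast hp.out.ne_zero) h1
  have hk : IsCoprime (p : ℤ) k := by
    refine (Nat.prime_iff_prime_int.1 hp.out).coprime_iff_not_dvd.2 fun ⟨l, hl⟩ => hne ?_
    rw [← orderOf_dvd_iff_zpow_eq_one, hx, hl]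
    exact ⟨l, by push_cast; ring⟩
  obtain ⟨a, b, hab⟩ := hk
  have h2 : x ^ p ^ n = (z ^ t) ^ b := by
    rw [← hst, ← zpow_mul, ← zpow_natCast]
    refine zpow_eq_zpow_iff_modEq.2 (Int.modEq_iff_dvd.2 ⟨-a, ?_⟩)
    rw [hx]
    push_cast
    linear_combination (p : ℤ) ^ n * hab
  rw [h2, ← zpow_mul]
  exact (hcen g).zpow_left _

/-- Higman's theorem for cyclic amalgamated subgroups: an amalgam of two finite `p`-groups with a
cyclic amalgamated subgroup embeds in a finite `p`-group. -/
theorem exists_common_overgroup {C : Type*} [Group C] [IsCyclic C] (N : ℕ) (P : Type u) (Q : Type v)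
    [Group P] [Group Q] [Finite P] [Finite Q] (hP : IsPGroup p P) (hQ : IsPGroup p Q) (i : C →* P)
    (j : C →* Q) (hker : i.ker = j.ker) (hN : Nat.card P + Nat.card Q ≤ N) :
    ∃ (R : Type (max u v)) (_ : Group R) (α : P →* R) (β : Q →* R), Finite R ∧ IsPGroup p R ∧
      Function.Injective α ∧ Function.Injective β ∧ α.comp i = β.comp j := by
  induction N generalizing P Q with
  | zero => have := Nat.card_pos (α := P); omega
  | succ N ih =>
  by_cases hPz : ∃ z : P, orderOf z = p ∧ (∀ g, Commute z g) ∧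
      ∀ (c : C) (t : ℤ), i c = z ^ t → i c = 1
  · obtain ⟨z, hz, hcen, hdis⟩ := hPz
    obtain ⟨P', _, π, _, hP', hcard, hπ⟩ := hP.exists_quotient_zpowers hz hcen
    have hker' : (π.comp i).ker = j.ker := by
      rw [← hker]
      ext c
      simp only [MonoidHom.mem_ker, MonoidHom.comp_apply]
      refine ⟨fun h => ?_, fun h => by rw [h, map_one]⟩
      obtain ⟨t, ht⟩ := (hπ _).1 h
      exact hdis c t ht
    obtain ⟨R, _, α, β, _, hR, hα, hβ, hαβ⟩ := ih P' Q hP' hQ (π.comp i) j hker' (by omega)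
    obtain ⟨α', β', h⟩ := exists_common_extension_of_disjoint hz hcen hπ hdis hα hβ hαβ
    exact ⟨_, inferInstance, α', β', inferInstance,
      CocycleExtension.isPGroup hR ZMod.natCast_smul_eq_zero, h⟩
  by_cases hQz : ∃ z : Q, orderOf z = p ∧ (∀ g, Commute z g) ∧
      ∀ (c : C) (t : ℤ), j c = z ^ t → j c = 1
  · obtain ⟨z, hz, hcen, hdis⟩ := hQz
    obtain ⟨Q', _, π, _, hQ', hcard, hπ⟩ := hQ.exists_quotient_zpowers hz hcen
    have hker' : i.ker = (π.comp j).ker := by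
      rw [hker]
      ext c
      simp only [MonoidHom.mem_ker, MonoidHom.comp_apply]
      refine ⟨fun h => by rw [h, map_one], fun h => ?_⟩
      obtain ⟨t, ht⟩ := (hπ _).1 h
      exact hdis c t ht
    obtain ⟨R, _, α, β, _, hR, hα, hβ, hαβ⟩ := ih P Q' hP hQ' i (π.comp j) hker' (by omega)
    obtain ⟨β', α', h1, h2, h3⟩ :=
      exists_common_extension_of_disjoint hz hcen hπ hdis hβ hα hαβ.symm
    exact ⟨_, inferInstance, α', β', inferInstance,
      CocycleExtension.isPGroup hR ZMod.natCast_smul_eq_zero, h2, h1, h3.symm⟩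
  -- Now all central subgroups of order `p` meet the images of `C`. Unless both groups are trivial,
  -- the subgroups of order `p` of the two cyclic images are central and correspond to each other,
  -- so they can be factored out together.
  push Not at hPz hQz
  rcases subsingleton_or_nontrivial P with hP1 | hP1
  · rcases subsingleton_or_nontrivial Q with hQ1 | hQ1
    · exact ⟨PUnit, inferInstance, 1, 1, inferInstance, IsPGroup.of_subsingleton p _,
        Function.injective_of_subsingleton _, Function.injective_of_subsingleton _, rfl⟩
    · obtain ⟨z, hz, hcen⟩ := hQ.exists_central_orderOf_eq
      obtain ⟨c, t, hc, hc1⟩ := hQz z hz hcen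
      have : c ∈ i.ker := Subsingleton.elim _ _
      rw [hker] at this
      exact absurd this hc1
  obtain ⟨z, hz, hcen⟩ := hP.exists_central_orderOf_eq
  obtain ⟨c₁, t, hc, hc1⟩ := hPz z hz hcen
  have hQ1 : Nontrivial Q := ⟨j c₁, 1, fun h => hc1 (by
    have : c₁ ∈ j.ker := h
    rwa [← hker] at this)⟩
  obtain ⟨z', hz', hcen'⟩ := hQ.exists_central_orderOf_eq
  obtain ⟨c₂, t', hc', hc1'⟩ := hQz z' hz' hcen'
  obtain ⟨x, hx⟩ := IsCyclic.exists_generator (α := C)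
  obtain ⟨s, rfl⟩ := Subgroup.mem_zpowers_iff.1 (hx c₁)
  obtain ⟨s', rfl⟩ := Subgroup.mem_zpowers_iff.1 (hx c₂)
  rw [map_zpow] at hc hc1 hc' hc1'
  have hord : orderOf (i x) = orderOf (j x) := by
    refine orderOf_eq_orderOf_iff.2 fun n => ?_
    rw [← map_pow, ← map_pow]
    exact SetLike.ext_iff.1 hker (x ^ n)
  obtain ⟨n, hn⟩ := IsPGroup.iff_orderOf.1 hP (i x)
  obtain ⟨n, rfl⟩ : ∃ m, n = m + 1 := Nat.exists_eq_succ_of_ne_zero <| by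
    rintro rfl
    rw [pow_zero, orderOf_eq_one_iff] at hn
    exact hc1 (by rw [hn, one_zpow])
  obtain ⟨hy, hyc⟩ := orderOf_pow_of_meets hn hz hcen hc hc1
  obtain ⟨hy', hyc'⟩ := orderOf_pow_of_meets (hord ▸ hn) hz' hcen' hc' hc1'
  rw [← map_pow] at hy hyc hy' hyc'
  obtain ⟨P', _, π, _, hP', hcard, hπ⟩ := hP.exists_quotient_zpowers hy hyc
  obtain ⟨Q', _, π', _, hQ', hcard', hπ'⟩ := hQ.exists_quotient_zpowers hy' hyc'
  have hker' : (π.comp i).ker = (π'.comp j).ker := by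
    ext c
    simp only [MonoidHom.mem_ker, MonoidHom.comp_apply, hπ, hπ']
    refine exists_congr fun t => ?_
    rw [← map_zpow, ← map_zpow, ← mul_inv_eq_one, ← mul_inv_eq_one (a := j c), ← map_inv, ← map_inv,
      ← map_mul, ← map_mul]
    exact SetLike.ext_iff.1 hker _
  obtain ⟨R, _, α, β, _, hR, hα, hβ, hαβ⟩ := ih P' Q' hP' hQ' _ _ hker' (by omega)
  obtain ⟨α', β', h⟩ :=
    exists_common_extension_of_common hker hy hy' hyc hyc' hπ hπ' hα hβ hαβ
  exact ⟨_, inferInstance, α', β', inferInstance,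
    CocycleExtension.isPGroup hR ZMod.natCast_smul_eq_zero, h⟩

end FinitePGroups

lemma IsPGroup.prod_of {p : ℕ} {P Q : Type*} [Group P] [Group Q] (hP : IsPGroup p P)
    (hQ : IsPGroup p Q) : IsPGroup p (P × Q) := by
  rintro ⟨a, b⟩
  obtain ⟨k, hk⟩ := hP a
  obtain ⟨l, hl⟩ := hQ b
  refine ⟨k + l, Prod.ext ?_ ?_⟩
  · simp [pow_add, pow_mul, hk]
  · simp [pow_add, mul_comm (p ^ k), pow_mul, hl]

/-! ### Generalities on separability and isolation -/

section Separability

variable {p : ℕ} {X : Type u} [Group X]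

lemma pSeparable_of_hom {F : Subgroup X}
    (h : ∀ g ∉ F, ∃ (R : Type u) (_ : Group R) (ρ : X →* R), Finite R ∧ IsPGroup p R ∧
      ∀ f ∈ F, ρ g ≠ ρ f) : PSeparable p F := by
  intro g hg
  obtain ⟨R, _, ρ, _, hR, hρ⟩ := h g hg
  refine ⟨ρ.range, inferInstance, ρ.rangeRestrict, inferInstance, hR.to_subgroup _,
    ρ.rangeRestrict_surjective, ?_⟩
  rintro ⟨f, hf, hfg⟩
  exact hρ f hf (congrArg Subtype.val hfg).symm

lemma PSeparable.exists_hom {F : Subgroup X} (h : PSeparable p F) {g : X} (hg : g ∉ F) :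
    ∃ (R : Type u) (_ : Group R) (ρ : X →* R), Finite R ∧ IsPGroup p R ∧ ∀ f ∈ F, ρ g ≠ ρ f := by
  obtain ⟨R, _, ρ, hfin, hR, -, hρ⟩ := h g hg
  exact ⟨R, _, ρ, hfin, hR, fun f hf hfg => hρ ⟨f, hf, hfg.symm⟩⟩

lemma ResiduallyPFinite.exists_hom (h : ResiduallyPFinite p X) {g : X} (hg : g ≠ 1) :
    ∃ (R : Type u) (_ : Group R) (ρ : X →* R), Finite R ∧ IsPGroup p R ∧ ρ g ≠ 1 := by
  obtain ⟨R, _, ρ, hfin, hR, hρ⟩ := PSeparable.exists_hom h (g := g) (by simpa using hg)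
  exact ⟨R, _, ρ, hfin, hR, by simpa using hρ⟩

lemma PSeparable.map_equiv {F : Subgroup X} (h : PSeparable p F) (e : X ≃* X) :
    PSeparable p (F.map e.toMonoidHom) := by
  refine pSeparable_of_hom fun g hg => ?_
  obtain ⟨R, _, ρ, hfin, hR, hρ⟩ := h.exists_hom (g := e.symm g)
    fun hg' => hg ⟨e.symm g, hg', by simp⟩
  refine ⟨R, _, ρ.comp e.symm.toMonoidHom, hfin, hR, ?_⟩
  rintro _ ⟨f, hf, rfl⟩
  simpa using hρ f hf

lemma PPrimeIsolated.map_equiv {Y : Subgroup X} (h : PPrimeIsolated p Y) (e : X ≃* X) :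
    PPrimeIsolated p (Y.map e.toMonoidHom) := by
  rintro g q hq hqp ⟨y, hy, hyg⟩
  refine ⟨e.symm g, h _ q hq hqp ?_, by simp⟩
  rw [← map_pow, ← hyg]
  simpa using hy

lemma PPrimeIsolated.comap {Z : Type*} [Group Z] {Y : Subgroup X} (h : PPrimeIsolated p Y)
    (f : Z →* X) : PPrimeIsolated p (Y.comap f) := fun g q hq hqp hg =>
  h (f g) q hq hqp (by simpa using hg)

lemma PPrimeIsolated.mem_of_pow_mem {Y : Subgroup X} (h : PPrimeIsolated p Y) {n : ℕ}
    (hn : ¬ p ∣ n) {g : X} (hg : g ^ n ∈ Y) : g ∈ Y := by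
  induction n using Nat.recOnMul generalizing g with
  | zero => simp at hn
  | one => simpa using hg
  | prime q hq => exact h g q hq (by rintro rfl; exact hn dvd_rfl) hg
  | mul a b iha ihb =>
    rw [pow_mul] at hg
    exact iha (fun hd => hn (hd.mul_right b)) (ihb (fun hd => hn (hd.mul_left a)) hg)

/-- The order of the image of `h` in a finite `p`-quotient can be raised to any power of `p` not
exceeding the order of `h`. -/
lemma ResiduallyPFinite.exists_orderOf_eq [hp : Fact p.Prime] (hX : ResiduallyPFinite p X) {h : X}
    {P : Type u} [Group P] [Finite P] (hP : IsPGroup p P) (a : X →* P) {m n : ℕ}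
    (ha : orderOf (a h) = p ^ m) (hmn : m ≤ n + 1) (hne : h ^ p ^ n ≠ 1) :
    ∃ (Q : Type u) (_ : Group Q) (b : X →* Q), Finite Q ∧ IsPGroup p Q ∧
      (∀ x, b x = 1 → a x = 1) ∧ orderOf (b h) = p ^ (n + 1) := by
  -- Where `h ^ p ^ n` survives, `h` has order at least `p ^ (n + 1)`; a further quotient makes this
  -- exact, and the product with `a` controls the kernel.
  obtain ⟨R, _, ρ, _, hR, hρ⟩ := hX.exists_hom hne
  obtain ⟨k, hk⟩ := IsPGroup.iff_orderOf.1 hR (ρ h)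
  have hnk : n + 1 ≤ k := by
    by_contra! hlt
    refine hρ ?_
    rw [map_pow, ← orderOf_dvd_iff_pow_eq_one, hk]
    exact pow_dvd_pow p (by omega)
  obtain ⟨Q, _, π, _, hQ, hπ⟩ := hR.exists_orderOf_eq hk hnk
  refine ⟨P × Q, inferInstance, a.prod (π.comp ρ), inferInstance, hP.prod_of hQ,
    fun x hx => congrArg Prod.fst hx, ?_⟩
  rw [Prod.orderOf]
  simp only [MonoidHom.prod_apply, MonoidHom.comp_apply, ha, hπ]
  exact Nat.lcm_eq_right (pow_dvd_pow p hmn)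

end Separability

/-! ### The amalgamated product and its factors -/

namespace AmalgamatedProduct

variable {A : Type u} {B : Type v} [Group A] [Group B] {H : Subgroup A} {K : Subgroup B}
  (φ : H ≃* K)

lemma inl_eq_inr (h : H) : inl φ h = inr φ (φ h : K) := by
  refine (QuotientGroup.eq_iff_div_mem).2 ?_
  rw [div_eq_mul_inv]
  exact Subgroup.subset_normalClosure ⟨h, rfl⟩

/-- The universal property of the amalgamated product. -/
def lift {R : Type*} [Group R] (α : A →* R) (β : B →* R) (hαβ : ∀ h : H, α h = β (φ h : K)) :
    AmalgamatedProduct φ →* R :=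
  QuotientGroup.lift _ (Monoid.Coprod.lift α β) <| by
    refine Subgroup.normalClosure_le_normal ?_
    rintro _ ⟨h, rfl⟩
    simp [MonoidHom.mem_ker, hαβ]

section lift

variable {R : Type*} [Group R] (α : A →* R) (β : B →* R) (hαβ : ∀ h : H, α h = β (φ h : K))

@[simp] lemma lift_inl (x : A) : lift φ α β hαβ (inl φ x) = α x := by
  simp [lift, inl]

@[simp] lemma lift_inr (x : B) : lift φ α β hαβ (inr φ x) = β x := by
  simp [lift, inr]

end lift

lemma hom_ext {R : Type*} [Group R] {f g : AmalgamatedProduct φ →* R}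
    (hl : ∀ x, f (inl φ x) = g (inl φ x)) (hr : ∀ x, f (inr φ x) = g (inr φ x)) : f = g := by
  refine QuotientGroup.monoidHom_ext _ (Monoid.Coprod.hom_ext ?_ ?_)
  · ext x; exact hl x
  · ext x; exact hr x

/-- The images of the two factors. -/
def factor (i : Bool) : Subgroup (AmalgamatedProduct φ) :=
  if i then (inl φ).range else (inr φ).range

/-- The amalgamated subgroup. -/
def base : Subgroup (AmalgamatedProduct φ) := H.map (inl φ)

lemma inl_mem_factor (x : A) : inl φ x ∈ factor φ true := ⟨x, rfl⟩

lemma inr_mem_factor (x : B) : inr φ x ∈ factor φ false := ⟨x, rfl⟩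

lemma inl_mem_base {x : A} (hx : x ∈ H) : inl φ x ∈ base φ := ⟨x, hx, rfl⟩

lemma inr_mem_base {x : B} (hx : x ∈ K) : inr φ x ∈ base φ :=
  ⟨φ.symm ⟨x, hx⟩, (φ.symm ⟨x, hx⟩).2, by rw [inl_eq_inr]; simp⟩

lemma base_le_factor (i : Bool) : base φ ≤ factor φ i := by
  rintro _ ⟨h, hh, rfl⟩
  cases i
  · exact ⟨φ ⟨h, hh⟩, (inl_eq_inr φ ⟨h, hh⟩).symm⟩
  · exact ⟨h, rfl⟩

lemma closure_factor : Subgroup.closure (⋃ i, (factor φ i : Set (AmalgamatedProduct φ))) = ⊤ := by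
  set N := Subgroup.closure (⋃ i, (factor φ i : Set (AmalgamatedProduct φ)))
  have hle : ∀ i, ∀ x ∈ factor φ i, x ∈ N := fun i x hx =>
    Subgroup.subset_closure (Set.mem_iUnion.2 ⟨i, hx⟩)
  -- Composed with the inclusion of `N`, this map fixes both factors, so it is the identity and `N`
  -- is everything.
  let f := lift φ ((inl φ).codRestrict N fun x => hle true _ (inl_mem_factor φ x))
    ((inr φ).codRestrict N fun x => hle false _ (inr_mem_factor φ x))
    fun h => Subtype.ext (inl_eq_inr φ h)
  have hf : N.subtype.comp f = MonoidHom.id _ := hom_ext φ (by simp [f]) (by simp [f])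
  refine (Subgroup.eq_top_iff' _).2 fun x => ?_
  rw [← MonoidHom.id_apply _ x, ← hf]
  exact (f x).2

/-! ### Dominating finite `p`-quotients of the factors -/

section FiniteQuotients

variable {p : ℕ} [hp : Fact p.Prime]

/-- Finite `p`-quotients of the factors are dominated by a finite `p`-quotient of the amalgamated
product, provided that the generators of the amalgamated subgroups have images of equal orders. -/
lemma exists_hom_of_ker_eq [IsCyclic H] {P : Type u} {Q : Type v} [Group P] [Group Q] [Finite P]
    [Finite Q] (hP : IsPGroup p P) (hQ : IsPGroup p Q) (a : A →* P) (b : B →* Q)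
    (hab : ∀ h : H, a h = 1 ↔ b (φ h : K) = 1) :
    ∃ (R : Type (max u v)) (_ : Group R) (ρ : AmalgamatedProduct φ →* R), Finite R ∧
      IsPGroup p R ∧ (∀ x, ρ (inl φ x) = 1 → a x = 1) ∧ (∀ x, ρ (inr φ x) = 1 → b x = 1) := by
  obtain ⟨R, _, α, β, hfin, hR, hα, hβ, hαβ⟩ := exists_common_overgroup _ P Q hP hQ
    (a.comp H.subtype) ((b.comp K.subtype).comp φ.toMonoidHom)
    (by ext h; exact hab h) le_rfl
  refine ⟨R, _, lift φ (α.comp a) (β.comp b) (fun h => DFunLike.congr_fun hαβ h), hfin, hR,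
    fun x hx => ?_, fun x hx => ?_⟩
  · exact (map_eq_one_iff α hα).1 ((lift_inl φ (α.comp a) (β.comp b) _ x).symm.trans hx)
  · exact (map_eq_one_iff β hβ).1 ((lift_inr φ (α.comp a) (β.comp b) _ x).symm.trans hx)

variable (hA : ResiduallyPFinite p A) (hB : ResiduallyPFinite p B)
include hA hB

/-- The generator of `H` has images of orders `p ^ m` and `p ^ n`. The smaller is raised to the
larger in a finer quotient, which is possible since `φ` preserves orders; the kernels on `H` then
agree. -/
lemma exists_hom [hH : IsCyclic H] {P : Type u} {Q : Type v} [Group P] [Group Q] [Finite P]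
    [Finite Q] (hP : IsPGroup p P) (hQ : IsPGroup p Q) (a : A →* P) (b : B →* Q) :
    ∃ (R : Type (max u v)) (_ : Group R) (ρ : AmalgamatedProduct φ →* R), Finite R ∧
      IsPGroup p R ∧ (∀ x, ρ (inl φ x) = 1 → a x = 1) ∧ (∀ x, ρ (inr φ x) = 1 → b x = 1) := by
  obtain ⟨h, hh⟩ := hH.exists_generator
  have key : ∀ {P : Type u} {Q : Type v} [Group P] [Group Q] (a : A →* P) (b : B →* Q),
      orderOf (a h) = orderOf (b (φ h : K)) → ∀ x : H, a x = 1 ↔ b (φ x : K) = 1 := by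
    intro P Q _ _ a b hab x
    obtain ⟨t, rfl⟩ := Subgroup.mem_zpowers_iff.1 (hh x)
    simp only [map_zpow, Subgroup.coe_zpow, ← orderOf_dvd_iff_zpow_eq_one, hab]
  obtain ⟨m, hm⟩ := IsPGroup.iff_orderOf.1 hP (a h)
  obtain ⟨n, hn⟩ := IsPGroup.iff_orderOf.1 hQ (b (φ h : K))
  have hpow : ∀ t : ℕ, (h : A) ^ t = 1 ↔ ((φ h : K) : B) ^ t = 1 := fun t => by
    rw [← Subgroup.coe_pow, ← Subgroup.coe_pow, ← map_pow, OneMemClass.coe_eq_one,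
      OneMemClass.coe_eq_one, map_eq_one_iff φ φ.injective]
  rcases lt_trichotomy m n with hlt | rfl | hlt
  · obtain ⟨n, rfl⟩ := Nat.exists_eq_succ_of_ne_zero (by omega : n ≠ 0)
    obtain ⟨P', _, a', _, hP', hle, hord⟩ := hA.exists_orderOf_eq hP a hm hlt.le (fun h1 => by
      have h2 : b (φ h : K) ^ p ^ n = 1 := by rw [← map_pow, (hpow _).1 h1, map_one]
      have h3 := orderOf_dvd_of_pow_eq_one h2
      rw [hn, Nat.pow_dvd_pow_iff_le_right hp.out.one_lt] at h3
      omega)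
    obtain ⟨R, _, ρ, hfin, hR, h1, h2⟩ :=
      exists_hom_of_ker_eq φ hP' hQ a' b (key a' b (hord.trans hn.symm))
    exact ⟨R, _, ρ, hfin, hR, fun x hx => hle x (h1 x hx), h2⟩
  · exact exists_hom_of_ker_eq φ hP hQ a b (key a b (hm.trans hn.symm))
  · obtain ⟨m, rfl⟩ := Nat.exists_eq_succ_of_ne_zero (by omega : m ≠ 0)
    obtain ⟨Q', _, b', _, hQ', hle, hord⟩ := hB.exists_orderOf_eq hQ b hn hlt.le (fun h1 => by
      have h2 : a h ^ p ^ m = 1 := by rw [← map_pow, (hpow _).2 h1, map_one]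
      have h3 := orderOf_dvd_of_pow_eq_one h2
      rw [hm, Nat.pow_dvd_pow_iff_le_right hp.out.one_lt] at h3
      omega)
    obtain ⟨R, _, ρ, hfin, hR, h1, h2⟩ :=
      exists_hom_of_ker_eq φ hP hQ' a b' (key a b' (hm.trans hord.symm))
    exact ⟨R, _, ρ, hfin, hR, h1, fun x hx => hle x (h2 x hx)⟩

/-- A `p`-separable subgroup of the left factor is separated, within this factor, by finite
`p`-quotients of the amalgamated product. -/
lemma exists_hom_inl [IsCyclic H] {D : Subgroup A} (hD : PSeparable p D) {x : A} (hx : x ∉ D) :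
    ∃ (R : Type (max u v)) (_ : Group R) (ρ : AmalgamatedProduct φ →* R), Finite R ∧
      IsPGroup p R ∧ ∀ d ∈ D.map (inl φ), ρ (inl φ x) ≠ ρ d := by
  obtain ⟨P, _, a, _, hP, ha⟩ := hD.exists_hom hx
  obtain ⟨R, _, ρ, hfin, hR, h1, -⟩ := exists_hom φ hA hB hP
    (IsPGroup.of_subsingleton p PUnit) a (1 : B →* PUnit)
  refine ⟨R, _, ρ, hfin, hR, ?_⟩
  rintro _ ⟨d, hd, rfl⟩ hxd
  refine ha d hd ?_
  have := h1 (x * d⁻¹) (by rw [map_mul, map_mul, hxd, ← map_mul, ← map_mul, mul_inv_cancel,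
    map_one, map_one])
  rwa [map_mul, map_inv, mul_inv_eq_one] at this

lemma exists_hom_inr [IsCyclic H] {D : Subgroup B} (hD : PSeparable p D) {x : B} (hx : x ∉ D) :
    ∃ (R : Type (max u v)) (_ : Group R) (ρ : AmalgamatedProduct φ →* R), Finite R ∧
      IsPGroup p R ∧ ∀ d ∈ D.map (inr φ), ρ (inr φ x) ≠ ρ d := by
  obtain ⟨Q, _, b, _, hQ, hb⟩ := hD.exists_hom hx
  obtain ⟨R, _, ρ, hfin, hR, -, h1⟩ := exists_hom φ hA hB
    (IsPGroup.of_subsingleton p PUnit) hQ (1 : A →* PUnit) b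
  refine ⟨R, _, ρ, hfin, hR, ?_⟩
  rintro _ ⟨d, hd, rfl⟩ hxd
  refine hb d hd ?_
  have := h1 (x * d⁻¹) (by rw [map_mul, map_mul, hxd, ← map_mul, ← map_mul, mul_inv_cancel,
    map_one, map_one])
  rwa [map_mul, map_inv, mul_inv_eq_one] at this

lemma inl_injective [IsCyclic H] : Function.Injective (inl φ) := by
  refine (injective_iff_map_eq_one _).2 fun x hx => ?_
  by_contra hne
  obtain ⟨R, _, ρ, -, -, hρ⟩ := exists_hom_inl φ hA hB hA (x := x) (by simpa using hne)
  exact hρ 1 (one_mem _) (by rw [hx])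

lemma inr_injective [IsCyclic H] : Function.Injective (inr φ) := by
  refine (injective_iff_map_eq_one _).2 fun x hx => ?_
  by_contra hne
  obtain ⟨R, _, ρ, -, -, hρ⟩ := exists_hom_inr φ hA hB hB (x := x) (by simpa using hne)
  exact hρ 1 (one_mem _) (by rw [hx])

omit hA hB

/-! ### One storey of the wreath-product tower -/

section Tower

variable {R : Type*} [Group R] (ρ : AmalgamatedProduct φ →* R)

open Classical in
/-- The indicator functions of the cosets of the image of the amalgamated subgroup. -/
noncomputable def cosetIndicator (p : ℕ) (y z : R) : ZMod p :=
  if ∃ g ∈ base φ, ρ g * z = y then 1 else 0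

lemma cosetIndicator_self (y : R) : cosetIndicator φ ρ p y y = 1 :=
  if_pos ⟨1, one_mem _, by simp⟩

lemma cosetIndicator_mul {v : AmalgamatedProduct φ} (hv : v ∉ ((base φ).map ρ).comap ρ) (y : R) :
    cosetIndicator φ ρ p (ρ v * y) y = 0 :=
  if_neg fun ⟨g, hg, h⟩ => hv ⟨g, hg, mul_right_cancel h⟩

omit hp in
lemma cosetIndicator_base_mul {g : AmalgamatedProduct φ} (hg : g ∈ base φ) (y : R) :
    cosetIndicator φ ρ p (ρ g * y) = cosetIndicator φ ρ p y := by
  funext z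
  suffices h : (∃ k ∈ base φ, ρ k * z = ρ g * y) ↔ ∃ k ∈ base φ, ρ k * z = y by
    by_cases h' : ∃ k ∈ base φ, ρ k * z = y
    · rw [cosetIndicator, cosetIndicator, if_pos h', if_pos (h.2 h')]
    · rw [cosetIndicator, cosetIndicator, if_neg h', if_neg (mt h.1 h')]
  constructor
  · rintro ⟨k, hk, h⟩
    exact ⟨g⁻¹ * k, mul_mem (inv_mem hg) hk, by rw [map_mul, mul_assoc, h]; simp⟩
  · rintro ⟨k, hk, h⟩
    exact ⟨g * k, mul_mem hg hk, by rw [map_mul, mul_assoc, h]⟩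

variable (p) in
/-- The homomorphism that is trivial, over `ρ`, on the left factor, and conjugate to the trivial
one by the function `cosetIndicator` on the right factor. -/
noncomputable def next : AmalgamatedProduct φ →* CocycleExtension (R → ZMod p) R :=
  lift φ (CocycleExtension.lift (ρ.comp (inl φ)) (fun _ _ => 0) (by simp))
    (CocycleExtension.lift (ρ.comp (inr φ))
      (fun b y => cosetIndicator φ ρ p (ρ (inr φ b) * y) - cosetIndicator φ ρ p y)
      (by intro g h y; simp only [map_mul, mul_assoc, MonoidHom.comp_apply]; abel))
    (fun h => by
      ext y
      · simp only [CocycleExtension.lift_fn]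
        rw [cosetIndicator_base_mul φ ρ (inr_mem_base φ (φ h).2), sub_self]
      · simp [inl_eq_inr])

lemma next_pt (g : AmalgamatedProduct φ) : (next φ p ρ g).pt = ρ g := by
  have : CocycleExtension.toBase.comp (next φ p ρ) = ρ := hom_ext φ (by simp [next])
    (by simp [next])
  exact DFunLike.congr_fun this g

lemma next_fn_true {g : AmalgamatedProduct φ} (hg : g ∈ factor φ true) (y : R) :
    (next φ p ρ g).fn y = 0 := by
  obtain ⟨x, rfl⟩ := hg
  simp [next]

lemma next_fn_false {g : AmalgamatedProduct φ} (hg : g ∈ factor φ false) (y : R) :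
    (next φ p ρ g).fn y = cosetIndicator φ ρ p (ρ g * y) - cosetIndicator φ ρ p y := by
  obtain ⟨x, rfl⟩ := hg
  simp [next]

lemma next_eq_one {i : Bool} {g : AmalgamatedProduct φ} (hg : g ∈ factor φ i) (h : ρ g = 1) :
    next φ p ρ g = 1 := by
  ext y
  · cases i
    · simp [next_fn_false φ ρ hg, h]
    · simp [next_fn_true φ ρ hg]
  · simp [next_pt, h]

variable {U' : Subgroup (AmalgamatedProduct φ)} {m : ℕ}
  (hm : ∀ i j n v, Reduced (Syllables (factor φ) U') i j n v → n ≤ m →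
    v ∉ ((base φ).map ρ).comap ρ)
include hm

/-- On the diagonal only the last syllable counts. Left-factor syllables contribute `0`; a
right-factor one contributes a difference of indicators, `0 - 1` at the end of the word and `0 - 0`
elsewhere, since nonempty suffixes avoid the coset of `y` by `hm`. -/
lemma next_fn_of_reduced {i j : Bool} {n : ℕ} {v : AmalgamatedProduct φ}
    (hv : Reduced (Syllables (factor φ) U') i j n v) (hn : n ≤ m) (y : R) :
    (next φ p ρ v).fn y y = if j then 0 else -1 := by
  induction hv with
  | @single i x hx =>
    cases i
    · simp [next_fn_false φ ρ hx.1, cosetIndicator_self,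
        cosetIndicator_mul φ ρ (hm _ _ _ _ (.single hx) hn)]
    · simp [next_fn_true φ ρ hx.1]
  | @cons i j n x w hx hw ih =>
    rw [map_mul, CocycleExtension.mul_fn, Pi.add_apply, ih (by omega), next_pt]
    cases i
    · rw [next_fn_false φ ρ hx.1, ← mul_assoc, ← map_mul, Pi.sub_apply,
        cosetIndicator_mul φ ρ (hm _ _ _ _ (.cons hx hw) hn),
        cosetIndicator_mul φ ρ (hm _ _ _ _ hw (by omega)), sub_zero, zero_add]
    · simp [next_fn_true φ ρ hx.1]

/-- A word `w * s` of length `m + 1` with last syllable `s` is evaluated at `1`, coordinate `ρ s`.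
The contributions of `w` and `s` are `-1` and `0`, or `0` and `1`, as they end in opposite factors;
on the amalgamated subgroup the value is `0`. -/
lemma notMem_of_length_le_succ (hm1 : 1 ≤ m) {i j : Bool} {n : ℕ} {v : AmalgamatedProduct φ}
    (hv : Reduced (Syllables (factor φ) U') i j n v) (hn : n ≤ m + 1) :
    v ∉ ((base φ).map (next φ p ρ)).comap (next φ p ρ) := by
  rintro ⟨g, hg, hgv⟩
  rcases hn.lt_or_eq with hn | rfl
  · refine hm _ _ _ _ hv (by omega) ⟨g, hg, ?_⟩
    rw [← next_pt φ (p := p), hgv, next_pt]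
  obtain ⟨k, w, s, rfl, hw, hs⟩ := hv.split m (by omega) (by omega)
  rw [Nat.add_sub_cancel_left] at hs
  have h1 := next_fn_of_reduced φ ρ (p := p) hm hw le_rfl (ρ s)
  have h2 : (next φ p ρ (w * s)).fn 1 (ρ s) = 0 := by
    rw [← hgv, next_fn_true φ ρ (base_le_factor φ true hg), Pi.zero_apply]
  have h3 : cosetIndicator φ ρ p 1 (ρ s) = 0 := by
    have := cosetIndicator_mul φ ρ (p := p) (hm _ _ _ _
      (hs.inv Reduced.syllables_inv) hm1) (ρ s)
    rwa [map_inv, inv_mul_cancel] at this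
  obtain ⟨rfl, hsyl⟩ := hs.of_length_one
  rw [map_mul, CocycleExtension.mul_fn, Pi.add_apply, next_pt, mul_one, h1] at h2
  cases k
  · rw [next_fn_true φ ρ hsyl.1] at h2
    simp at h2
  · rw [next_fn_false φ ρ hsyl.1, mul_one, Pi.sub_apply, cosetIndicator_self, h3] at h2
    simp at h2

end Tower

/-- Every finite `p`-quotient of an amalgamated product can be refined, without changing the
kernels on the factors, so that no reduced word of length at most `m` enters the amalgamated
subgroup. -/
theorem exists_tower {R₀ : Type (max u v)} [Group R₀] [Finite R₀] (hR₀ : IsPGroup p R₀)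
    (ρ₀ : AmalgamatedProduct φ →* R₀) (m : ℕ) :
    ∃ (R : Type (max u v)) (_ : Group R) (ρ : AmalgamatedProduct φ →* R), Finite R ∧
      IsPGroup p R ∧ (∀ g, ρ g = 1 → ρ₀ g = 1) ∧
      (∀ i, ∀ g ∈ factor φ i, ρ₀ g = 1 → ρ g = 1) ∧
      ∀ i j n v, Reduced (Syllables (factor φ) (((base φ).map ρ₀).comap ρ₀)) i j n v →
        n ≤ m + 1 → v ∉ ((base φ).map ρ).comap ρ := by
  induction m with
  | zero =>
    refine ⟨R₀, _, ρ₀, inferInstance, hR₀, fun _ h => h, fun _ _ _ h => h, ?_⟩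
    intro i j n v hv hn
    obtain rfl : n = 1 := le_antisymm hn hv.pos
    exact hv.of_length_one.2.2
  | succ m ih =>
    obtain ⟨R, _, ρ, _, hR, h1, h2, h3⟩ := ih
    refine ⟨CocycleExtension (R → ZMod p) R, inferInstance, next φ p ρ, inferInstance,
      CocycleExtension.isPGroup hR (fun v => by ext; simp), fun g hg => h1 g ?_,
      fun i g hg h => next_eq_one φ ρ hg (h2 i g hg h), ?_⟩
    · rw [← next_pt φ (p := p), hg, CocycleExtension.one_pt]
    · intro i j n v hv hn
      exact notMem_of_length_le_succ φ ρ h3 (by omega) hv hn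

end FiniteQuotients

end AmalgamatedProduct

/-! ### Normal forms, residual finiteness and subgroups of the factors -/

namespace AmalgamatedProduct

variable {A : Type u} {B : Type v} [Group A] [Group B] {H : Subgroup A} {K : Subgroup B}
  (φ : H ≃* K) {p : ℕ} [hp : Fact p.Prime]

lemma syllables_mono {R R' : Type*} [Group R] [Group R'] {ρ : AmalgamatedProduct φ →* R}
    {ρ' : AmalgamatedProduct φ →* R'} (h : ∀ g, ρ' g = 1 → ρ g = 1) (i : Bool) :
    Syllables (factor φ) (((base φ).map ρ).comap ρ) i ⊆
      Syllables (factor φ) (((base φ).map ρ').comap ρ') i := by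
  rintro x ⟨hx, hxU⟩
  refine ⟨hx, fun ⟨y, hy, hyx⟩ => hxU ⟨y, hy, ?_⟩⟩
  have := h (y * x⁻¹) (by rw [map_mul, map_inv, hyx, mul_inv_cancel])
  rwa [map_mul, map_inv, mul_inv_eq_one] at this

variable (hA : ResiduallyPFinite p A) (hB : ResiduallyPFinite p B)
  (hH : PSeparable p H) (hK : PSeparable p K) [IsCyclic H]
include hA hB hH hK

/-- Reduced words stay reduced in all sufficiently fine finite `p`-quotients. -/
lemma exists_hom_reduced {i j : Bool} {n : ℕ} {v : AmalgamatedProduct φ}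
    (hv : Reduced (Syllables (factor φ) (base φ)) i j n v) :
    ∃ (R : Type (max u v)) (_ : Group R) (ρ : AmalgamatedProduct φ →* R), Finite R ∧
      IsPGroup p R ∧ Reduced (Syllables (factor φ) (((base φ).map ρ).comap ρ)) i j n v := by
  have key : ∀ i, ∀ x ∈ Syllables (factor φ) (base φ) i,
      ∃ (R : Type (max u v)) (_ : Group R) (ρ : AmalgamatedProduct φ →* R), Finite R ∧
      IsPGroup p R ∧ x ∈ Syllables (factor φ) (((base φ).map ρ).comap ρ) i := by
    rintro (_ | _) x ⟨hx, hxU⟩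
    · obtain ⟨y, rfl⟩ := hx
      obtain ⟨R, _, ρ, hfin, hR, hρ⟩ := exists_hom_inr φ hA hB hK
        (fun hy => hxU (inr_mem_base φ hy))
      refine ⟨R, _, ρ, hfin, hR, ⟨y, rfl⟩, ?_⟩
      rintro ⟨_, ⟨h, hh, rfl⟩, hhy⟩
      refine hρ (inl φ h) ⟨φ ⟨h, hh⟩, (φ ⟨h, hh⟩).2, (inl_eq_inr φ ⟨h, hh⟩).symm⟩ hhy.symm
    · obtain ⟨y, rfl⟩ := hx
      obtain ⟨R, _, ρ, hfin, hR, hρ⟩ := exists_hom_inl φ hA hB hH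
        (fun hy => hxU (inl_mem_base φ hy))
      refine ⟨R, _, ρ, hfin, hR, ⟨y, rfl⟩, ?_⟩
      rintro ⟨g, hg, hgy⟩
      exact hρ g hg hgy.symm
  induction hv with
  | single hx =>
    obtain ⟨R, _, ρ, hfin, hR, hρ⟩ := key _ _ hx
    exact ⟨R, _, ρ, hfin, hR, .single hρ⟩
  | cons hx _ ih =>
    obtain ⟨R, _, ρ, _, hR, hρ⟩ := key _ _ hx
    obtain ⟨R', _, ρ', _, hR', hρ'⟩ := ih
    refine ⟨R × R', inferInstance, ρ.prod ρ', inferInstance, hR.prod_of hR', .cons ?_ ?_⟩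
    · exact syllables_mono φ (fun g hg => congrArg Prod.fst hg) _ hρ
    · exact hρ'.mono (syllables_mono φ (fun g hg => congrArg Prod.snd hg))

/-- Reduced words of positive length do not represent elements of the amalgamated subgroup. -/
lemma notMem_base {i j : Bool} {n : ℕ} {v : AmalgamatedProduct φ}
    (hv : Reduced (Syllables (factor φ) (base φ)) i j n v) : v ∉ base φ := by
  obtain ⟨R₀, _, ρ₀, _, hR₀, h₀⟩ := exists_hom_reduced φ hA hB hH hK hv
  obtain ⟨R, _, ρ, -, -, -, -, h⟩ := exists_tower φ hR₀ ρ₀ n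
  exact fun hvU => h _ _ _ _ h₀ (by omega) ⟨v, hvU, rfl⟩

theorem residuallyPFinite : ResiduallyPFinite p (AmalgamatedProduct φ) := by
  refine pSeparable_of_hom fun g hg => ?_
  simp only [Subgroup.mem_bot] at hg
  rcases Reduced.exists_of_closure (base_le_factor φ) (closure_factor φ) g with
    ⟨h, hh, rfl⟩ | ⟨i, j, n, hv⟩
  · obtain ⟨R, _, ρ, hfin, hR, hρ⟩ := exists_hom_inl φ hA hB hA (x := h) (by
      rintro rfl
      exact hg (map_one _))
    exact ⟨R, _, ρ, hfin, hR, by simpa using hρ⟩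
  · obtain ⟨R₀, _, ρ₀, _, hR₀, h₀⟩ := exists_hom_reduced φ hA hB hH hK hv
    obtain ⟨R, _, ρ, hfin, hR, -, -, h⟩ := exists_tower φ hR₀ ρ₀ n
    refine ⟨R, _, ρ, hfin, hR, ?_⟩
    simp only [Subgroup.mem_bot, forall_eq]
    exact fun hρ => h _ _ _ _ h₀ (by omega) ⟨1, one_mem _, hρ.symm⟩

/-- A subgroup of a factor that is separated within this factor is `p`-separable. -/
theorem pSeparable_of_le_factor {D : Subgroup (AmalgamatedProduct φ)} {i : Bool}
    (hD : D ≤ factor φ i) (hsep : ∀ g ∈ factor φ i, g ∉ D →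
      ∃ (R : Type (max u v)) (_ : Group R) (ρ : AmalgamatedProduct φ →* R), Finite R ∧
      IsPGroup p R ∧ ∀ d ∈ D, ρ g ≠ ρ d) : PSeparable p D := by
  refine pSeparable_of_hom fun g hg => ?_
  by_cases hgi : g ∈ factor φ i
  · exact hsep g hgi hg
  rcases Reduced.exists_of_closure (base_le_factor φ) (closure_factor φ) g with
    hgU | ⟨a, b, n, hv⟩
  · exact absurd (base_le_factor φ i hgU) hgi
  obtain ⟨R₀, _, ρ₀, _, hR₀, h₀⟩ := exists_hom_reduced φ hA hB hH hK hv
  obtain ⟨R, _, ρ, hfin, hR, -, hker, h⟩ := exists_tower φ hR₀ ρ₀ n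
  refine ⟨R, _, ρ, hfin, hR, fun d hd => ?_⟩
  replace hd := hD hd
  -- If `ρ w = ρ d`, either `d` agrees under `ρ₀`, hence under `ρ`, with an element of the
  -- amalgamated subgroup, or `d⁻¹ * w` is a reduced word of length at most `n + 1` killed by `ρ`.
  have key : ∀ {b : Bool} {k : ℕ} {w d : AmalgamatedProduct φ},
      Reduced (Syllables (factor φ) (((base φ).map ρ₀).comap ρ₀)) (!i) b k w → k ≤ n →
      d ∈ factor φ i → ρ w ≠ ρ d := by
    intro b k w d hw hk hd hwd
    by_cases hdU : d ∈ ((base φ).map ρ₀).comap ρ₀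
    · obtain ⟨e, he, hed⟩ := hdU
      have h1 := hker i (e * d⁻¹) (mul_mem (base_le_factor φ i he) (inv_mem hd))
        (by rw [map_mul, map_inv, hed, mul_inv_cancel])
      rw [map_mul, map_inv, mul_inv_eq_one, ← hwd] at h1
      exact h _ _ _ _ hw (by omega) ⟨e, he, h1⟩
    · refine h _ _ _ _ (.cons (Reduced.syllables_inv i d ⟨hd, hdU⟩) hw) (by omega)
        ⟨1, one_mem _, ?_⟩
      rw [map_mul, map_inv, hwd, inv_mul_cancel]
      exact map_one ρ
  by_cases ha : a = !i
  · subst ha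
    exact key h₀ le_rfl hd
  obtain rfl : a = i := by revert ha; cases a <;> cases i <;> simp
  cases h₀ with
  | single hx => exact absurd hx.1 hgi
  | cons hx hw =>
    -- A first syllable in factor `i` is absorbed into `d`.
    rename_i n x w
    intro hgd
    refine key hw (by omega) (mul_mem (inv_mem hx.1) hd) ?_
    rw [map_mul ρ x⁻¹, map_inv, ← hgd, map_mul, inv_mul_cancel_left]

/-! ### Cyclic subgroups generated by cyclically reduced elements -/

/-- Every finite `p`-quotient is dominated by one in which a cyclically reduced element has
arbitrarily large order, while the orders of the elements of the amalgamated subgroup are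
bounded. -/
lemma exists_hom_large_order {i : Bool} {n : ℕ} {c : AmalgamatedProduct φ}
    (hc : Reduced (Syllables (factor φ) (base φ)) i (!i) n c) {R₁ : Type (max u v)} [Group R₁]
    [Finite R₁] (hR₁ : IsPGroup p R₁) (ρ₁ : AmalgamatedProduct φ →* R₁) :
    ∃ s : ℕ, (∀ g, ρ₁ (g ^ p ^ s) = 1) ∧
      ∀ L, ∃ (R : Type (max u v)) (_ : Group R) (ρ : AmalgamatedProduct φ →* R), Finite R ∧
      IsPGroup p R ∧ (∀ g, ρ g = 1 → ρ₁ g = 1) ∧ (∀ g ∈ base φ, ρ (g ^ p ^ s) = 1) ∧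
      p ^ L ∣ orderOf (ρ c) := by
  obtain ⟨R₂, _, ρ₂, _, hR₂, h₂⟩ := exists_hom_reduced φ hA hB hH hK hc
  have h₀ := h₂.mono (syllables_mono φ (ρ' := ρ₁.prod ρ₂) fun g hg => congrArg Prod.snd hg)
  have hR₀ := hR₁.prod_of hR₂
  obtain ⟨s, hs⟩ := hR₀.exists_card_eq
  have hpow : ∀ g, (ρ₁.prod ρ₂) (g ^ p ^ s) = 1 := fun g => by
    rw [map_pow, ← hs, pow_card_eq_one']
  refine ⟨s, fun g => congrArg Prod.fst (hpow g), fun L => ?_⟩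
  obtain ⟨R, _, ρ, hfin, hR, h1, h2, h3⟩ := exists_tower φ hR₀ (ρ₁.prod ρ₂) (p ^ L * n)
  refine ⟨R, _, ρ, hfin, hR, fun g hg => congrArg Prod.fst (h1 g hg), fun g hg =>
    h2 true _ (pow_mem (base_le_factor φ true hg) _) (hpow g), ?_⟩
  obtain ⟨m, hm⟩ := IsPGroup.iff_orderOf.1 hR (ρ c)
  rw [hm]
  refine pow_dvd_pow p ?_
  by_contra! hlt
  -- `c ^ p ^ L` is reduced of length `p ^ L * n`, within reach of the tower, so it survives.
  have h4 := h₀.pow (p ^ L - 1)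
  rw [Nat.sub_add_cancel (Nat.one_le_pow _ _ hp.out.pos)] at h4
  refine h3 _ _ _ _ h4 (by omega) ⟨1, one_mem _, ?_⟩
  rw [map_one, map_pow, eq_comm, ← orderOf_dvd_iff_pow_eq_one, hm]
  exact pow_dvd_pow p hlt.le

/-- A `p'`-isolated subgroup generated by a cyclically reduced element is `p`-separable. -/
theorem pSeparable_zpowers {i : Bool} {n : ℕ} {c : AmalgamatedProduct φ}
    (hc : Reduced (Syllables (factor φ) (base φ)) i (!i) n c)
    (hiso : PPrimeIsolated p (Subgroup.zpowers c)) : PSeparable p (Subgroup.zpowers c) := by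
  refine pSeparable_of_hom fun g hg => ?_
  by_contra! hcon
  have hcl : ∀ (R : Type (max u v)) [Group R] (ρ : AmalgamatedProduct φ →* R), Finite R →
      IsPGroup p R → ∃ k : ℤ, ρ g = ρ c ^ k := by
    intro R _ ρ hfin hR
    obtain ⟨f, hf, hgf⟩ := hcon R _ ρ hfin hR
    obtain ⟨k, rfl⟩ := Subgroup.mem_zpowers_iff.1 hf
    exact ⟨k, by rw [hgf, map_zpow]⟩
  have hres := residuallyPFinite φ hA hB hH hK
  have hgc : Commute g c := by
    by_contra hne
    obtain ⟨R, _, ρ, hfin, hR, hρ⟩ := hres.exists_hom (g := g * c * (c * g)⁻¹)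
      (fun h => hne (mul_inv_eq_one.1 h))
    obtain ⟨k, hk⟩ := hcl R ρ hfin hR
    refine hρ ?_
    rw [map_mul, map_inv, mul_inv_eq_one, map_mul, map_mul, hk]
    exact ((Commute.refl _).zpow_left k).eq
  obtain ⟨b, a, hb, hba⟩ := Reduced.exists_pow_mul_zpow_mem (base_le_factor φ)
    (fun i j n x => notMem_base φ hA hB hH hK) (closure_factor φ) hc hgc
  obtain ⟨β, b', hb', rfl⟩ := Nat.exists_eq_pow_mul_and_not_dvd hb.ne' p hp.out.ne_one
  have hppos : ∀ k : ℕ, (p : ℤ) ^ k ≠ 0 := fun k => pow_ne_zero _ (by exact_mod_cast hp.out.ne_zero)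
  have hzpow : ∀ {R : Type (max u v)} [Group R] (ρ : AmalgamatedProduct φ →* R) (k a : ℤ) (b : ℕ),
      ρ g = ρ c ^ k → ρ (g ^ b * c ^ a) = ρ c ^ (k * b + a) := by
    intro R _ ρ k a b hk
    rw [map_mul, map_pow, map_zpow, hk, zpow_add, zpow_mul, zpow_natCast]
  -- The `p ^ s`-th power of `g ^ b * c ^ a` dies under `ρ`, while the order of `ρ c` is divisible
  -- by `p ^ (L + s)`.
  have hbound : ∀ {R : Type (max u v)} [Group R] (ρ : AmalgamatedProduct φ →* R) (k : ℤ) (s L : ℕ),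
      ρ g = ρ c ^ k → (∀ g ∈ base φ, ρ (g ^ p ^ s) = 1) → p ^ (L + s) ∣ orderOf (ρ c) →
      (p : ℤ) ^ L ∣ k * (p ^ β * b' : ℕ) + a := by
    intro R _ ρ k s L hk hs hL
    have h1 := hs _ hba
    rw [map_pow, hzpow ρ k a _ hk, ← zpow_natCast, ← zpow_mul, ← orderOf_dvd_iff_zpow_eq_one] at h1
    have h2 := (Int.natCast_dvd_natCast.2 hL).trans h1
    push_cast at h2 ⊢
    rw [pow_add] at h2
    exact Int.dvd_of_mul_dvd_mul_right (hppos s) h2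
  obtain ⟨a', rfl⟩ : (p : ℤ) ^ β ∣ a := by
    obtain ⟨s, -, hs⟩ := exists_hom_large_order φ hA hB hH hK hc
      (IsPGroup.of_subsingleton p PUnit) 1
    obtain ⟨R, _, ρ, hfin, hR, -, h1, h2⟩ := hs (β + s)
    obtain ⟨k, hk⟩ := hcl R ρ hfin hR
    have h3 := hbound ρ k s β hk h1 h2
    refine (dvd_add_right ?_).1 h3
    push_cast
    exact ⟨k * b', by ring⟩
  -- The only use of `p'`-isolation: otherwise `g ^ b' ∈ ⟨c⟩` with `b'` prime to `p`.
  have he : g ^ b' * c ^ a' ≠ 1 := by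
    intro h
    refine hg (hiso.mem_of_pow_mem hb' (g := g) ?_)
    rw [mul_eq_one_iff_eq_inv.1 h]
    exact inv_mem (Subgroup.zpow_mem_zpowers c a')
  obtain ⟨R₁, _, ρ₁, _, hR₁, h₁⟩ := hres.exists_hom he
  obtain ⟨s, hs1, hs⟩ := exists_hom_large_order φ hA hB hH hK hc hR₁ ρ₁
  -- One `s` pays for the exponent of the amalgamated subgroup and `β` for the factor `p ^ β`; the
  -- other `s` makes `p ^ s` divide `k * b' + a'`, so that `ρ₁` kills `c ^ (k * b' + a')`.
  obtain ⟨R, _, ρ, hfin, hR, hle, h1, h2⟩ := hs (s + β + s)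
  obtain ⟨k, hk⟩ := hcl R ρ hfin hR
  have h3 := hbound ρ k s (s + β) hk h1 h2
  have h4 : (p : ℤ) ^ s ∣ k * b' + a' := by
    refine Int.dvd_of_mul_dvd_mul_right (hppos β) ?_
    rw [← pow_add]
    convert h3 using 1
    push_cast
    ring
  obtain ⟨l, hl⟩ := h4
  have h5 : ρ (g ^ b' * c ^ a' * (c ^ (k * b' + a'))⁻¹) = 1 := by
    rw [map_mul, hzpow ρ k a' b' hk, map_inv, map_zpow, mul_inv_cancel]
  have h6 := hle _ h5
  rw [map_mul, map_inv, mul_inv_eq_one, hl, zpow_mul] at h6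
  refine h₁ (h6.trans ?_)
  rw [map_zpow, ← Nat.cast_pow, zpow_natCast, hs1, one_zpow]

theorem conditionStarStar : ConditionStarStar p φ := by
  intro C hCcyc hCiso hCA hCB
  obtain ⟨c, rfl⟩ := (Subgroup.isCyclic_iff_exists_zpowers_eq_top C).1 hCcyc
  have hconj : ∃ g : AmalgamatedProduct φ, (∃ k, g * c * g⁻¹ ∈ factor φ k) ∨
      ∃ k m, Reduced (Syllables (factor φ) (base φ)) k (!k) m (g * c * g⁻¹) := by
    rcases Reduced.exists_of_closure (base_le_factor φ) (closure_factor φ) c with h | ⟨i, j, n, h⟩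
    · exact ⟨1, .inl ⟨true, by simpa using base_le_factor φ true h⟩⟩
    · exact h.exists_conj (base_le_factor φ)
  obtain ⟨g, hg⟩ := hconj
  have hmap : (Subgroup.zpowers c).map (MulAut.conj g).toMonoidHom =
      Subgroup.zpowers (g * c * g⁻¹) := by
    rw [MonoidHom.map_zpowers]; rfl
  have hback : Subgroup.zpowers c =
      (Subgroup.zpowers (g * c * g⁻¹)).map (MulAut.conj g⁻¹).toMonoidHom := by
    rw [MonoidHom.map_zpowers]
    congr 1
    simp [mul_assoc]
  have hiso := hCiso.map_equiv (MulAut.conj g)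
  rw [hmap] at hiso
  rw [hback]
  refine PSeparable.map_equiv ?_ _
  rcases hg with ⟨k, hk⟩ | ⟨k, m, hk⟩
  · have hle : Subgroup.zpowers (g * c * g⁻¹) ≤ factor φ k := Subgroup.zpowers_le.2 hk
    refine pSeparable_of_le_factor φ hA hB hH hK hle ?_
    cases k
    · have hD := Subgroup.map_comap_eq_self (f := inr φ) hle
      have hcyc : IsCyclic ((Subgroup.zpowers (g * c * g⁻¹)).comap (inr φ)) :=
        isCyclic_of_injective ((inr φ).subgroupComap (Subgroup.zpowers (g * c * g⁻¹)))
          fun x y hxy => Subtype.ext (inr_injective φ hA hB (congrArg Subtype.val hxy))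
      have hsep : PSeparable p ((Subgroup.zpowers (g * c * g⁻¹)).comap (inr φ)) := by
        by_contra hns
        exact hCB _ ⟨hcyc, hiso.comap _, hns⟩ ⟨g⁻¹, by rw [hD]; exact hback⟩
      rintro _ ⟨x, rfl⟩ hx
      have := exists_hom_inr φ hA hB hsep hx
      rwa [hD] at this
    · have hD := Subgroup.map_comap_eq_self (f := inl φ) hle
      have hcyc : IsCyclic ((Subgroup.zpowers (g * c * g⁻¹)).comap (inl φ)) :=
        isCyclic_of_injective ((inl φ).subgroupComap (Subgroup.zpowers (g * c * g⁻¹)))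
          fun x y hxy => Subtype.ext (inl_injective φ hA hB (congrArg Subtype.val hxy))
      have hsep : PSeparable p ((Subgroup.zpowers (g * c * g⁻¹)).comap (inl φ)) := by
        by_contra hns
        exact hCA _ ⟨hcyc, hiso.comap _, hns⟩ ⟨g⁻¹, by rw [hD]; exact hback⟩
      rintro _ ⟨x, rfl⟩ hx
      have := exists_hom_inl φ hA hB hsep hx
      rwa [hD] at this
  · exact pSeparable_zpowers φ hA hB hH hK hk hiso

end AmalgamatedProduct

theorem theorem2p2 {A : Type u} {B : Type v} [Group A] [Group B] (p : ℕ) (hp : p.Prime)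
    (H : Subgroup A) (K : Subgroup B) (φ : H ≃* K)
    (hA : ResiduallyPFinite p A) (hB : ResiduallyPFinite p B)
    (hHcyc : IsCyclic H) (hKcyc : IsCyclic K)
    (hHsep : PSeparable p H) (hKsep : PSeparable p K) :
    ResiduallyPFinite p (AmalgamatedProduct φ) ∧ ConditionStarStar p φ := by
  have : Fact p.Prime := ⟨hp⟩
  exact ⟨AmalgamatedProduct.residuallyPFinite φ hA hB hHsep hKsep,
    AmalgamatedProduct.conditionStarStar φ hA hB hHsep hKsep⟩
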